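/- **Setting.** Let $f,g_1,\dots,g_m:\mathbb R^n\to\mathbb R^n$ with $f(0)=0$, put $f_c(x,u)=f(x)+\sum_{i=1}^m u_i g_i(x)$, and consider $\dot x(t)=f_c(x(t),u(t))$. Let $\mathbb X\subseteq\mathbb R^n$ be compact and let $\mathbb U\subseteq\mathbb R^m$ be compact with $0\in\operatorname{int}\mathbb U$. For every $\hat x\in\mathbb X$ and every constant input $u\in\mathbb U$ the solution $x(t;\hat x,u)$ is assumed to exist for all $t\ge 0$, to be unique, and to stay in $\mathbb X$; the Koopman operator is $(\mathcal K_t^u\varphi)(\hat x)=\varphi(x(t;\hat x,u))$. Assume that $f_c$ is continuous and locally Lipschitz in its first argument around the origin, i.e. for each $u$ the map $f_c(\cdot,u)$ is Lipschitz on some neighbourhood of $0$. Let $N\ge n$, let $\phi_{n+1},\dots,\phi_N\in C^1(\mathbb R^n,\mathbb R)$ vanish at $0$, and put $\hat\Phi(x)=(x,\phi_{n+1}(x),\dots,\phi_N(x))\in\mathbb R^N$, $\Phi(x)=(1,\hat\Phi(x))\in\mathbb R^{N+1}$. Norms of vectors are Euclidean. **Data and surrogate.** Let $\Delta t>0$.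 For each $\bar u\in\{0,e_1,\dots,e_m\}$ let $x^{\bar u}_1,x^{\bar u}_2,\dots$ be i.i.d. random points of $\mathbb X$, and let $y_j^{\bar u}=x(\Delta t;x_j^{\bar u},\bar u)$. For an amount of data $d\in\mathbb N$ let $A\in\mathbb R^{N\times N}$ and $b_{0,i}\in\mathbb R^N$, $\hat B_i\in\mathbb R^{N\times N}$ ($i=1,\dots,m$) be minimizers of the least-squares problems $$\min_{A}\big\|[\hat\Phi(y_j^{0})]_{j\le d}-A[\hat\Phi(x_j^{0})]_{j\le d}\big\|_{\mathrm F},\qquad \min_{b_{0,i},\hat B_i}\big\|[\hat\Phi(y_j^{e_i})]_{j\le d}-[\,b_{0,i}\ \ \hat B_i\,][\Phi(x_j^{e_i})]_{j\le d}\big\|_{\mathrm F}.$$ Put $B_0=[b_{0,1}\cdots b_{0,m}]$, $\tilde B=[\hat B_1-A\ \cdots\ \hat B_m-A]$, $\mathcal K^0_{\Delta t,d}=\begin{bmatrix}1&0\\0&A\end{bmatrix}$, $\mathcal K^{e_i}_{\Delta t,d}=\begin{bmatrix}1&0\\b_{0,i}&\hat B_i\end{bmatrix}$ and $\mathcal K^u_{\Delta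 t,d}=\mathcal K^0_{\Delta t,d}+\sum_i u_i(\mathcal K^{e_i}_{\Delta t,d}-\mathcal K^0_{\Delta t,d})$. Let $\delta\in(0,1)$, $c_x,c_u>0$ and $d_0\in\mathbb N$ be such that for every $d\ge d_0$, with probability at least $1-\delta$, $$\|(\mathcal K^u_{\Delta t}\Phi)(x)-\mathcal K^u_{\Delta t,d}\Phi(x)\|\le c_x\|\Phi(x)-\Phi(0)\|+c_u\|u\|\qquad\text{for all }x\in\mathbb X,\ u\in\mathbb U.$$ **Design.** Let $Q_z\prec0$, $s_z\in\mathbb R^N$, $r_z>0$, and write $\begin{bmatrix}\tilde Q_z&\tilde s_z\\\tilde s_z^\top&\tilde r_z\end{bmatrix}=\begin{bmatrix}Q_z&s_z\\s_z^\top&r_z\end{bmatrix}^{-1}$. Call $0\prec P=P^\top\in\mathbb R^{N\times N}$, $L\in\mathbb R^{m\times N}$, $L_w\in\mathbb R^{m\times Nm}$, $0\prec\Lambda=\Lambda^\top\in\mathbb R^{m\times m}$, $\nu>0$, $\tau>0$ feasible (for the surrogate at hand) if $$\begin{bmatrix} P-\tau I_N & -\tilde B(\Lambda\otimes\tilde s_z)-B_0L_w(I_m\otimes\tilde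 s_z) & 0 & AP+B_0L & \tilde B(\Lambda\otimes I_N)+B_0L_w\\ \star & \tilde r_z\Lambda-L_w(I_m\otimes\tilde s_z)-(I_m\otimes\tilde s_z^\top)L_w^\top & -(I_m\otimes\tilde s_z^\top)\begin{bmatrix}0\\L_w\end{bmatrix}^\top & L & L_w\\ \star&\star&\tfrac{\tau}{2}\begin{bmatrix}c_x^{-2}I_N&0\\0&c_u^{-2}I_m\end{bmatrix}&\begin{bmatrix}P\\L\end{bmatrix}&\begin{bmatrix}0\\L_w\end{bmatrix}\\ \star&\star&\star&P&0\\ \star&\star&\star&\star&-(\Lambda\otimes\tilde Q_z^{-1}) \end{bmatrix}\succ0$$ and $$\begin{bmatrix}\nu\tilde r_z-1&-\nu\tilde s_z^\top\\-\nu\tilde s_z&\nu\tilde Q_z+P\end{bmatrix}\preceq0 .$$ Put $\mathcal X_{\mathrm{RoA}}=\{x\in\mathbb R^n\mid\hat\Phi(x)^\top P^{-1}\hat\Phi(x)\le1\}$ and $\mu(x)=(I-L_w(\Lambda^{-1}\otimes\hat\Phi(x)))^{-1}LP^{-1}\hat\Phi(x)$. **Claim.** For every $d\ge d_0$, with probability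 at least $1-\delta$ the following holds for all feasible $(P,L,L_w,\Lambda,\nu,\tau)$ with $\mathcal X_{\mathrm{RoA}}\subseteq\mathbb X$ and $\mu(\mathcal X_{\mathrm{RoA}})\subseteq\mathbb U$. The matrix inverted in $\mu(x)$ is invertible for all $x\in\mathcal X_{\mathrm{RoA}}$, and the sampled controller $\mu_{\mathrm s}(x(t))=\mu(x(k\Delta t))$ for $t\in[k\Delta t,(k+1)\Delta t)$, $k\ge0$, exponentially stabilizes the continuous-time system on $\mathcal X_{\mathrm{RoA}}$: there are $C\ge1$ and $\eta>0$ such that for every $\hat x\in\mathcal X_{\mathrm{RoA}}$ the closed loop has a solution on $[0,\infty)$ with $x(0)=\hat x$, and every closed-loop solution on an interval $[0,T]$ with $x(0)=\hat x$ satisfies $\|x(t)\|\le Ce^{-\eta t}\|\hat x\|$ for all $t\in[0,T]$. -/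

import Mathlib

open MeasureTheory ProbabilityTheory Topology
open scoped Matrix Kronecker

noncomputable section

namespace SafEDMD

/-- `ℝⁿ` with the Euclidean norm. -/
abbrev E (n : ℕ) : Type := EuclideanSpace ℝ (Fin n)

/-- Index set of the `N = n + q` non-constant observables: the `n` state coordinates followed by
`q` further observables. -/
abbrev Idx (n q : ℕ) : Type := Fin n ⊕ Fin q

/-! ### The control system -/

/-- The vector field `f_c(x, u) = f(x) + ∑ i, u_i g_i(x)`. -/
def vectorField {n m : ℕ} (f : E n → E n) (g : Fin m → E n → E n) (x : E n) (u : E m) : E n :=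
  f x + ∑ i, u i • g i x

/-- `z` solves `ż = f_c(z, u)` on `[0, T]` with `z 0 = x₀`. The inputs used below are continuous
from the right and piecewise constant, so a solution is a continuous curve whose right derivative
is given by the vector field at every time. -/
def IsSolution {n m : ℕ} (f : E n → E n) (g : Fin m → E n → E n) (u : ℝ → E m) (x₀ : E n)
    (T : ℝ) (z : ℝ → E n) : Prop :=
  z 0 = x₀ ∧ ContinuousOn z (Set.Icc 0 T) ∧
    ∀ t ∈ Set.Ico 0 T, HasDerivWithinAt z (vectorField f g (z t) (u t)) (Set.Ici t) t

/-- For initial values in `X` and constant inputs in `U` the solution exists for all times, is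
unique, and does not leave `X`. -/
def FlowInvariant {n m : ℕ} (f : E n → E n) (g : Fin m → E n → E n) (X : Set (E n))
    (U : Set (E m)) : Prop :=
  ∀ x₀ ∈ X, ∀ u ∈ U,
    (∃ z : ℝ → E n, (∀ T, IsSolution f g (fun _ => u) x₀ T z) ∧ ∀ t, 0 ≤ t → z t ∈ X) ∧
    ∀ (T : ℝ) (z z' : ℝ → E n), IsSolution f g (fun _ => u) x₀ T z →
      IsSolution f g (fun _ => u) x₀ T z' → Set.EqOn z z' (Set.Icc 0 T)

open Classical in
/-- The solution `t ↦ x(t; x₀, u)` for the constant input `u`. -/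
def trajectory {n m : ℕ} (f : E n → E n) (g : Fin m → E n → E n) (u : E m) (x₀ : E n) :
    ℝ → E n :=
  if h : ∃ z : ℝ → E n, ∀ T, IsSolution f g (fun _ => u) x₀ T z then h.choose else fun _ => x₀

/-- The Koopman operator `(𝒦_t^u φ)(x) = φ(x(t; x, u))`, acting componentwise on vector-valued
observables. -/
def koopman {n m : ℕ} {F : Type*} (f : E n → E n) (g : Fin m → E n → E n) (u : E m) (t : ℝ)
    (φ : E n → F) : E n → F :=
  fun x => φ (trajectory f g u x t)

/-! ### Observables -/

/-- The reduced lifting function `Φ̂(x) = (x, φ_{n+1}(x), …, φ_N(x))`. -/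
def liftRed {n q : ℕ} (φ : Fin q → E n → ℝ) (x : E n) : EuclideanSpace ℝ (Idx n q) :=
  WithLp.toLp 2 (Sum.elim (fun i => x i) (fun l => φ l x))

/-- The lifting function `Φ(x) = (1, Φ̂(x))`. -/
def lift {n q : ℕ} (φ : Fin q → E n → ℝ) (x : E n) : EuclideanSpace ℝ (Unit ⊕ Idx n q) :=
  WithLp.toLp 2 (Sum.elim (fun _ => 1) (fun k => liftRed φ x k))

/-! ### Data and the learned surrogate -/

/-- The inputs used for sampling: `none` stands for `0`, `some i` for the unit vector `e_i`. -/
def sampleInput {m : ℕ} : Option (Fin m) → E m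
  | none => 0
  | some i => EuclideanSpace.single i 1

/-- For each sampling input the states `x_j` are drawn i.i.d. from `X`, and `y_j` is the state
reached from `x_j` after time `Δt` under that constant input. -/
structure IsData {n m : ℕ} {Ω : Type*} [MeasurableSpace Ω] (Pr : Measure Ω)
    (f : E n → E n) (g : Fin m → E n → E n) (X : Set (E n)) (Δt : ℝ)
    (x y : Option (Fin m) → ℕ → Ω → E n) : Prop where
  measurable : ∀ v j, Measurable (x v j)
  indep : ∀ v, iIndepFun (x v) Pr
  identDistrib : ∀ v j, IdentDistrib (x v j) (x v 0) Pr Pr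
  mem : ∀ v j ω, x v j ω ∈ X
  successor : ∀ v j ω, ∃ z : ℝ → E n,
    IsSolution f g (fun _ => sampleInput v) (x v j ω) Δt z ∧ y v j ω = z Δt

/-- The Frobenius norm. -/
def frobNorm {α β : Type*} [Fintype α] [Fintype β] (M : Matrix α β ℝ) : ℝ :=
  Real.sqrt (∑ a, ∑ b, M a b ^ 2)

/-- The matrices `A`, `b_{0,i}`, `B̂_i` of the surrogate model. -/
structure Surrogate (n q m : ℕ) where
  /-- the matrix `A` -/
  A : Matrix (Idx n q) (Idx n q) ℝ
  /-- the vectors `b_{0,i}` -/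
  b : Fin m → Idx n q → ℝ
  /-- the matrices `B̂_i` -/
  Bhat : Fin m → Matrix (Idx n q) (Idx n q) ℝ

namespace Surrogate

/-- `B₀ = [b_{0,1} ⋯ b_{0,m}]`. -/
def B₀ {n q m : ℕ} (S : Surrogate n q m) : Matrix (Idx n q) (Fin m) ℝ :=
  Matrix.of fun a i => S.b i a

/-- `B̃ = [B̂₁ - A ⋯ B̂_m - A]`; the column with index `(i, c)` is column `c` of block `i`. -/
def Btilde {n q m : ℕ} (S : Surrogate n q m) : Matrix (Idx n q) (Fin m × Idx n q) ℝ :=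
  Matrix.of fun a p => (S.Bhat p.1 - S.A) a p.2

/-- `𝒦_{Δt,d}^0`. -/
def K₀ {n q m : ℕ} (S : Surrogate n q m) : Matrix (Unit ⊕ Idx n q) (Unit ⊕ Idx n q) ℝ :=
  Matrix.fromBlocks 1 0 0 S.A

/-- `𝒦_{Δt,d}^{e_i}`. -/
def Ke {n q m : ℕ} (S : Surrogate n q m) (i : Fin m) :
    Matrix (Unit ⊕ Idx n q) (Unit ⊕ Idx n q) ℝ :=
  Matrix.fromBlocks 1 0 (Matrix.replicateCol Unit (S.b i)) (S.Bhat i)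

/-- `𝒦_{Δt,d}^u = 𝒦_{Δt,d}^0 + ∑ i, u_i (𝒦_{Δt,d}^{e_i} - 𝒦_{Δt,d}^0)`. -/
def K {n q m : ℕ} (S : Surrogate n q m) (u : E m) :
    Matrix (Unit ⊕ Idx n q) (Unit ⊕ Idx n q) ℝ :=
  S.K₀ + ∑ i, u i • (S.Ke i - S.K₀)

end Surrogate

/-- The matrix with columns `Φ̂(x_1), …, Φ̂(x_d)`. -/
def redDataMatrix {n q : ℕ} (φ : Fin q → E n → ℝ) (d : ℕ) (x : ℕ → E n) :
    Matrix (Idx n q) (Fin d) ℝ :=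
  Matrix.of fun k j => liftRed φ (x j) k

/-- The matrix with columns `Φ(x_1), …, Φ(x_d)`. -/
def dataMatrix {n q : ℕ} (φ : Fin q → E n → ℝ) (d : ℕ) (x : ℕ → E n) :
    Matrix (Unit ⊕ Idx n q) (Fin d) ℝ :=
  Matrix.of fun k j => lift φ (x j) k

/-- `S` solves the least-squares problems built from the first `d` samples for each input. -/
structure IsEDMD {n q m : ℕ} (φ : Fin q → E n → ℝ) (d : ℕ)
    (x y : Option (Fin m) → ℕ → E n) (S : Surrogate n q m) : Prop where
  minA : ∀ A' : Matrix (Idx n q) (Idx n q) ℝ,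
    frobNorm (redDataMatrix φ d (y none) - S.A * redDataMatrix φ d (x none)) ≤
      frobNorm (redDataMatrix φ d (y none) - A' * redDataMatrix φ d (x none))
  minB : ∀ (i : Fin m) (b' : Idx n q → ℝ) (B' : Matrix (Idx n q) (Idx n q) ℝ),
    frobNorm (redDataMatrix φ d (y (some i)) -
        Matrix.fromCols (Matrix.replicateCol Unit (S.b i)) (S.Bhat i) *
          dataMatrix φ d (x (some i))) ≤
      frobNorm (redDataMatrix φ d (y (some i)) -
        Matrix.fromCols (Matrix.replicateCol Unit b') B' * dataMatrix φ d (x (some i)))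

/-- The proportional bound
`‖(𝒦_{Δt}^u Φ)(x) - 𝒦_{Δt,d}^u Φ(x)‖ ≤ c_x ‖Φ(x) - Φ(0)‖ + c_u ‖u‖` on `X × U`. -/
def ErrorBound {n q m : ℕ} (f : E n → E n) (g : Fin m → E n → E n) (φ : Fin q → E n → ℝ)
    (X : Set (E n)) (U : Set (E m)) (Δt cx cu : ℝ) (S : Surrogate n q m) : Prop :=
  ∀ x ∈ X, ∀ u ∈ U,
    ‖koopman f g u Δt (lift φ) x - WithLp.toLp 2 (S.K u *ᵥ (lift φ x).ofLp)‖ ≤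
      cx * ‖lift φ x - lift φ 0‖ + cu * ‖u‖

/-- The property `A` holds with probability at least `p`. -/
def WithProb {Ω : Type*} [MeasurableSpace Ω] (Pr : Measure Ω) (p : ℝ) (A : Ω → Prop) : Prop :=
  ∃ G : Set Ω, MeasurableSet G ∧ p ≤ Pr.real G ∧ ∀ ω ∈ G, A ω

/-! ### Controller design -/

/-- The matrix `[Q_z s_z; s_zᵀ r_z]`. -/
def zMatrix {ι : Type*} (Q : Matrix ι ι ℝ) (s : ι → ℝ) (r : ℝ) :
    Matrix (ι ⊕ Unit) (ι ⊕ Unit) ℝ :=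
  Matrix.fromBlocks Q (Matrix.replicateCol Unit s) (Matrix.replicateRow Unit s)
    (Matrix.of fun _ _ => r)

/-- The block `Q̃_z` of the inverse of `[Q_z s_z; s_zᵀ r_z]`. -/
def Qinv {ι : Type*} [Fintype ι] [DecidableEq ι] (Q : Matrix ι ι ℝ) (s : ι → ℝ) (r : ℝ) :
    Matrix ι ι ℝ :=
  (zMatrix Q s r)⁻¹.toBlocks₁₁

/-- The block `s̃_z` of the inverse of `[Q_z s_z; s_zᵀ r_z]`. -/
def sinv {ι : Type*} [Fintype ι] [DecidableEq ι] (Q : Matrix ι ι ℝ) (s : ι → ℝ) (r : ℝ) :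
    ι → ℝ :=
  fun k => (zMatrix Q s r)⁻¹.toBlocks₁₂ k ()

/-- The block `r̃_z` of the inverse of `[Q_z s_z; s_zᵀ r_z]`. -/
def rinv {ι : Type*} [Fintype ι] [DecidableEq ι] (Q : Matrix ι ι ℝ) (s : ι → ℝ) (r : ℝ) : ℝ :=
  (zMatrix Q s r)⁻¹.toBlocks₂₂ () ()

/-- The Kronecker product `M ⊗ v` with a column vector `v`. -/
def kronCol {α β ι : Type*} (M : Matrix α β ℝ) (v : ι → ℝ) : Matrix (α × ι) β ℝ :=
  (M ⊗ₖ Matrix.replicateCol Unit v).submatrix id (fun j => (j, ()))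

/-- The symmetric block matrix `[M R; ⋆ D]`. -/
def symBlocks {α β : Type*} (M : Matrix α α ℝ) (R : Matrix α β ℝ) (D : Matrix β β ℝ) :
    Matrix (α ⊕ β) (α ⊕ β) ℝ :=
  Matrix.fromBlocks M R Rᵀ D

/-- The matrix of the stability condition, with block rows and columns of sizes
`N`, `m`, `N + m`, `N`, `N m`. -/
def stabilityMatrix {n q m : ℕ} (S : Surrogate n q m) (cx cu : ℝ)
    (Qt : Matrix (Idx n q) (Idx n q) ℝ) (st : Idx n q → ℝ) (rt : ℝ)
    (P : Matrix (Idx n q) (Idx n q) ℝ) (L : Matrix (Fin m) (Idx n q) ℝ)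
    (Lw : Matrix (Fin m) (Fin m × Idx n q) ℝ) (Λ : Matrix (Fin m) (Fin m) ℝ) (τ : ℝ) :
    Matrix (Idx n q ⊕ Fin m ⊕ (Idx n q ⊕ Fin m) ⊕ Idx n q ⊕ (Fin m × Idx n q))
      (Idx n q ⊕ Fin m ⊕ (Idx n q ⊕ Fin m) ⊕ Idx n q ⊕ (Fin m × Idx n q)) ℝ :=
  let Is : Matrix (Fin m × Idx n q) (Fin m) ℝ := kronCol 1 st
  let Lw0 : Matrix (Idx n q ⊕ Fin m) (Fin m × Idx n q) ℝ := Matrix.fromRows 0 Lw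
  symBlocks (P - τ • (1 : Matrix (Idx n q) (Idx n q) ℝ))
    (Matrix.fromCols (-(S.Btilde * kronCol Λ st) - S.B₀ * Lw * Is)
      (Matrix.fromCols 0
        (Matrix.fromCols (S.A * P + S.B₀ * L)
          (S.Btilde * (Λ ⊗ₖ (1 : Matrix (Idx n q) (Idx n q) ℝ)) + S.B₀ * Lw))))
    (symBlocks (rt • Λ - Lw * Is - Isᵀ * Lwᵀ)
      (Matrix.fromCols (-(Isᵀ * Lw0ᵀ)) (Matrix.fromCols L Lw))
      (symBlocks
        ((τ / 2) • Matrix.fromBlocks ((cx ^ 2)⁻¹ • (1 : Matrix (Idx n q) (Idx n q) ℝ)) 0 0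
          ((cu ^ 2)⁻¹ • (1 : Matrix (Fin m) (Fin m) ℝ)))
        (Matrix.fromCols (Matrix.fromRows P L) Lw0)
        (symBlocks P 0 (-(Λ ⊗ₖ Qt⁻¹)))))

/-- The matrix `[ν r̃_z - 1, -ν s̃_zᵀ; -ν s̃_z, ν Q̃_z + P]` of the invariance condition. -/
def invarianceMatrix {ι : Type*} (Qt : Matrix ι ι ℝ) (st : ι → ℝ) (rt : ℝ) (P : Matrix ι ι ℝ)
    (ν : ℝ) : Matrix (Unit ⊕ ι) (Unit ⊕ ι) ℝ :=
  symBlocks (Matrix.of fun _ _ => ν * rt - 1) (-(ν • Matrix.replicateRow Unit st)) (ν • Qt + P)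

/-- The matrix inequalities of the controller design, for the set of all `ψ` with
`ψᵀ Q ψ + 2 sᵀ ψ + r ≥ 0`. -/
structure IsFeasible {n q m : ℕ} (S : Surrogate n q m) (cx cu : ℝ)
    (Q : Matrix (Idx n q) (Idx n q) ℝ) (s : Idx n q → ℝ) (r : ℝ)
    (P : Matrix (Idx n q) (Idx n q) ℝ) (L : Matrix (Fin m) (Idx n q) ℝ)
    (Lw : Matrix (Fin m) (Fin m × Idx n q) ℝ) (Λ : Matrix (Fin m) (Fin m) ℝ) (ν τ : ℝ) :
    Prop where
  posP : P.PosDef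
  posΛ : Λ.PosDef
  posν : 0 < ν
  posτ : 0 < τ
  stability :
    (stabilityMatrix S cx cu (Qinv Q s r) (sinv Q s r) (rinv Q s r) P L Lw Λ τ).PosDef
  invariance : (-invarianceMatrix (Qinv Q s r) (sinv Q s r) (rinv Q s r) P ν).PosSemidef

/-- The matrix `I - L_w (Λ⁻¹ ⊗ Φ̂(x))` inverted in the control law. -/
def gainMatrix {n q m : ℕ} (φ : Fin q → E n → ℝ) (Lw : Matrix (Fin m) (Fin m × Idx n q) ℝ)
    (Λ : Matrix (Fin m) (Fin m) ℝ) (x : E n) : Matrix (Fin m) (Fin m) ℝ :=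
  1 - Lw * kronCol Λ⁻¹ (liftRed φ x).ofLp

/-- The control law `μ(x) = (I - L_w (Λ⁻¹ ⊗ Φ̂(x)))⁻¹ L P⁻¹ Φ̂(x)`. -/
def controller {n q m : ℕ} (φ : Fin q → E n → ℝ) (P : Matrix (Idx n q) (Idx n q) ℝ)
    (L : Matrix (Fin m) (Idx n q) ℝ) (Lw : Matrix (Fin m) (Fin m × Idx n q) ℝ)
    (Λ : Matrix (Fin m) (Fin m) ℝ) (x : E n) : E m :=
  WithLp.toLp 2 (((gainMatrix φ Lw Λ x)⁻¹ * L * P⁻¹) *ᵥ (liftRed φ x).ofLp)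

/-- `{x | Φ̂(x)ᵀ P⁻¹ Φ̂(x) ≤ 1}`. -/
def roa {n q : ℕ} (φ : Fin q → E n → ℝ) (P : Matrix (Idx n q) (Idx n q) ℝ) : Set (E n) :=
  {x | (liftRed φ x).ofLp ⬝ᵥ (P⁻¹ *ᵥ (liftRed φ x).ofLp) ≤ 1}

/-- The sampled feedback along `z`: the input `μ(z(kΔt))` on `[kΔt, (k+1)Δt)`. -/
def sampleHold {n m : ℕ} (μ : E n → E m) (Δt : ℝ) (z : ℝ → E n) (t : ℝ) : E m :=
  μ (z ((⌊t / Δt⌋₊ : ℝ) * Δt))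

/-- Exponential stability, for all initial values in `R`, of the continuous-time system under the
sampled feedback `μ`: closed-loop solutions exist for all times, and all closed-loop solutions,
on any time horizon, decay exponentially with uniform constants. -/
def SampledExpStable {n m : ℕ} (f : E n → E n) (g : Fin m → E n → E n) (μ : E n → E m) (Δt : ℝ)
    (R : Set (E n)) : Prop :=
  ∃ C η : ℝ, 1 ≤ C ∧ 0 < η ∧ ∀ x₀ ∈ R,
    (∃ z : ℝ → E n, ∀ T, IsSolution f g (sampleHold μ Δt z) x₀ T z) ∧
    ∀ (T : ℝ) (z : ℝ → E n), IsSolution f g (sampleHold μ Δt z) x₀ T z →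
      ∀ t ∈ Set.Icc 0 T, ‖z t‖ ≤ C * Real.exp (-η * t) * ‖x₀‖

end SafEDMD

end

namespace SafEDMD

open Matrix

/-! ### Quadratic forms -/

/-! On the event where the error bound holds everything is deterministic. The Lyapunov function is
`V(x) = Φ̂(x)ᵀ P⁻¹ Φ̂(x)`, with the region of attraction as its unit sublevel set.

No Schur complement or S-procedure is invoked: the large matrix is tested on well-chosen vectors.
The invariance inequality gives, for `ψ = Φ̂(x)` with `x` in the region, the dual inequality `H = r̃
ψψᵀ - s̃ψᵀ - ψs̃ᵀ + Q̃ ⪯ 0` (`neg_dualForm_posSemidef`). The second and fifth block components can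
then be chosen so that together they contribute `γᵀ(Λ ⊗ H)γ ≤ 0` (`multiplier_nonpos`,
`stabilityMatrix_quad_le`). A left null vector of `I - L_w(Λ⁻¹ ⊗ ψ)` would produce a nonzero test
vector with nonpositive form, so the controller is well defined.

For the decrease, write the true next lifted state as `ψ' = Aψ + B₀u + B̃(I ⊗ ψ)u + e` and take
first component `P⁻¹ψ'`, fourth component `-P⁻¹ψ`, and third component proportional to `(ψ, u)`.
After Young's inequality for `e`, the form is at most `V(x) - V(x')`; being positive definite it
dominates a multiple of `‖ψ‖² + ‖u‖²` (`exists_decrease_of_stability`). This one estimate gives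
invariance of the region, contraction of `V` at the sampling instants, and the linear bound `‖μ(x)‖
≤ κ‖x‖`.

Between samples Grönwall's inequality bounds the state by a multiple of its last sampled value.
Sandwiching `V` between multiples of `‖x‖²` turns the contraction into exponential decay
(`sampledExpStable_of_lyapunov`). -/

lemma dotProduct_self_eq_norm_sq {ι : Type*} [Fintype ι] (v : EuclideanSpace ℝ ι) :
    v.ofLp ⬝ᵥ v.ofLp = ‖v‖ ^ 2 := by
  rw [EuclideanSpace.real_norm_sq_eq]
  simp [dotProduct, pow_two]

/-- A positive definite quadratic form is bounded below by a multiple of the squared norm. -/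
lemma exists_pos_mul_dotProduct_le {ι : Type*} [Fintype ι] {M : Matrix ι ι ℝ} (hM : M.PosDef) :
    ∃ ε : ℝ, 0 < ε ∧ ∀ v : ι → ℝ, ε * (v ⬝ᵥ v) ≤ v ⬝ᵥ (M *ᵥ v) := by
  classical
  let K : Set (EuclideanSpace ℝ ι) := Metric.sphere 0 1
  have hK : IsCompact K := isCompact_sphere 0 1
  have hc : Continuous fun v : EuclideanSpace ℝ ι => v.ofLp ⬝ᵥ (M *ᵥ v.ofLp) := by
    have : Continuous fun v : EuclideanSpace ℝ ι => v.ofLp := PiLp.continuous_ofLp 2 _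
    fun_prop
  -- The unit sphere is empty exactly when there are no coordinates; otherwise its minimum of the
  -- form is the constant.
  rcases K.eq_empty_or_nonempty with hE | hne
  · refine ⟨1, one_pos, fun v => ?_⟩
    have h0 : v = 0 := by
      by_contra hv
      have hn : ‖WithLp.toLp 2 v‖ ≠ 0 := by simpa using hv
      have : (‖WithLp.toLp 2 v‖⁻¹ • WithLp.toLp 2 v : EuclideanSpace ℝ ι) ∈ K := by
        simp only [K, mem_sphere_zero_iff_norm, norm_smul, norm_inv, norm_norm]
        exact inv_mul_cancel₀ hn
      rw [hE] at this
      exact this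
    simp [h0]
  · obtain ⟨w, hw, hmin⟩ := hK.exists_isMinOn hne hc.continuousOn
    have hw0 : w.ofLp ≠ 0 := by
      intro h
      have : w = 0 := by ext i; simpa using congrFun h i
      simp [K, this] at hw
    refine ⟨w.ofLp ⬝ᵥ (M *ᵥ w.ofLp), by simpa using hM.dotProduct_mulVec_pos hw0, fun v => ?_⟩
    by_cases hv : v = 0
    · simp [hv]
    have hn : ‖WithLp.toLp 2 v‖ ≠ 0 := by simpa using hv
    have hmem : (‖WithLp.toLp 2 v‖⁻¹ • WithLp.toLp 2 v : EuclideanSpace ℝ ι) ∈ K := by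
      simp only [K, mem_sphere_zero_iff_norm, norm_smul, norm_inv, norm_norm]
      exact inv_mul_cancel₀ hn
    have h := hmin hmem
    have hs := dotProduct_self_eq_norm_sq (WithLp.toLp 2 v)
    simp only [Set.mem_ofPred_eq, WithLp.ofLp_smul, mulVec_smul, dotProduct_smul, smul_dotProduct,
      smul_eq_mul] at h hs
    rw [hs]
    generalize ‖WithLp.toLp 2 v‖ = ρ at *
    have hρ : 0 < ρ ^ 2 := by positivity
    calc _ ≤ ρ⁻¹ * (ρ⁻¹ * (v ⬝ᵥ (M *ᵥ v))) * ρ ^ 2 := mul_le_mul_of_nonneg_right h hρ.le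
      _ = _ := by field_simp

/-- Every quadratic form is bounded above by a multiple of the squared norm. -/
lemma exists_dotProduct_mulVec_le {ι : Type*} [Fintype ι] (M : Matrix ι ι ℝ) :
    ∃ b : ℝ, 0 < b ∧ ∀ v : ι → ℝ, v ⬝ᵥ (M *ᵥ v) ≤ b * (v ⬝ᵥ v) := by
  refine ⟨1 + ∑ i, ∑ j, |M i j|, by positivity, fun v => ?_⟩
  have hv : ∀ i, v i ^ 2 ≤ v ⬝ᵥ v := fun i => by
    simp only [dotProduct, ← pow_two]
    exact Finset.single_le_sum (f := fun i => v i ^ 2) (fun j _ => sq_nonneg _) (Finset.mem_univ i)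
  have h0 : 0 ≤ v ⬝ᵥ v := by simpa using dotProduct_star_self_nonneg v
  have : v ⬝ᵥ (M *ᵥ v) ≤ ∑ i, ∑ j, |M i j| * (v ⬝ᵥ v) := by
    simp only [dotProduct, mulVec, Finset.mul_sum]
    refine Finset.sum_le_sum fun i _ => Finset.sum_le_sum fun j _ => ?_
    have h1 : v i * v j ≤ v ⬝ᵥ v := by nlinarith [hv i, hv j, sq_nonneg (v i - v j)]
    have h2 : -(v i * v j) ≤ v ⬝ᵥ v := by nlinarith [hv i, hv j, sq_nonneg (v i + v j)]
    calc v i * (M i j * v j) = M i j * (v i * v j) := by ring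
      _ ≤ |M i j * (v i * v j)| := le_abs_self _
      _ = |M i j| * |v i * v j| := abs_mul _ _
      _ ≤ |M i j| * (v ⬝ᵥ v) := by gcongr; exact abs_le'.2 ⟨h1, h2⟩
      _ = _ := by simp [dotProduct, Finset.mul_sum]
  simp only [← Finset.sum_mul] at this
  linarith

lemma symBlocks_quad {α β : Type*} [Fintype α] [Fintype β] (M : Matrix α α ℝ) (R : Matrix α β ℝ)
    (D : Matrix β β ℝ) (x : α → ℝ) (y : β → ℝ) :
    Sum.elim x y ⬝ᵥ (symBlocks M R D *ᵥ Sum.elim x y) =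
      x ⬝ᵥ (M *ᵥ x) + 2 * (x ⬝ᵥ (R *ᵥ y)) + y ⬝ᵥ (D *ᵥ y) := by
  have h : y ⬝ᵥ (Rᵀ *ᵥ x) = x ⬝ᵥ (R *ᵥ y) := by
    rw [mulVec_transpose, dotProduct_comm, dotProduct_mulVec]
  simp only [symBlocks, fromBlocks_mulVec, Sum.elim_comp_inl, Sum.elim_comp_inr,
    sumElim_dotProduct_sumElim, dotProduct_add, h]
  ring

lemma kronCol_apply {α β ι : Type*} (M : Matrix α β ℝ) (v : ι → ℝ) (p : α × ι) (j : β) :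
    kronCol M v p j = M p.1 j * v p.2 := rfl

lemma kronCol_eq_mul {α ι : Type*} [Fintype α] [DecidableEq α] [Fintype ι] [DecidableEq ι]
    (M : Matrix α α ℝ) (v : ι → ℝ) :
    kronCol M v = (M ⊗ₖ (1 : Matrix ι ι ℝ)) * kronCol (1 : Matrix α α ℝ) v := by
  ext ⟨i, k⟩ j
  simp [kronCol_apply, Matrix.mul_apply, Fintype.sum_prod_type, Matrix.one_apply]

/-- The quadratic form of the stability condition, sorted by the two eliminated blocks. -/
lemma stabilityMatrix_quad {n q m : ℕ} (S : Surrogate n q m) (cx cu : ℝ)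
    (Qt : Matrix (Idx n q) (Idx n q) ℝ) (st : Idx n q → ℝ) (rt : ℝ)
    (P : Matrix (Idx n q) (Idx n q) ℝ) (L : Matrix (Fin m) (Idx n q) ℝ)
    (Lw : Matrix (Fin m) (Fin m × Idx n q) ℝ) (Λ : Matrix (Fin m) (Fin m) ℝ) (τ : ℝ)
    (p c₁ d : Idx n q → ℝ) (a c₂ σ : Fin m → ℝ) (h : Fin m × Idx n q → ℝ)
    (hσ : σ = p ᵥ* S.B₀ + a + c₂) :
    Sum.elim p (Sum.elim a (Sum.elim (Sum.elim c₁ c₂) (Sum.elim d h))) ⬝ᵥ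
      (stabilityMatrix S cx cu Qt st rt P L Lw Λ τ *ᵥ
        Sum.elim p (Sum.elim a (Sum.elim (Sum.elim c₁ c₂) (Sum.elim d h)))) =
      p ⬝ᵥ (P *ᵥ p) - τ * (p ⬝ᵥ p) +
        τ / 2 * ((cx ^ 2)⁻¹ * (c₁ ⬝ᵥ c₁) + (cu ^ 2)⁻¹ * (c₂ ⬝ᵥ c₂)) +
        (rt * (a ⬝ᵥ (Λ *ᵥ a)) -
          2 * (p ⬝ᵥ (S.Btilde *ᵥ ((Λ ⊗ₖ (1 : Matrix (Idx n q) (Idx n q) ℝ)) *ᵥ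
              (kronCol (1 : Matrix (Fin m) (Fin m) ℝ) st *ᵥ a))) +
            σ ⬝ᵥ (Lw *ᵥ (kronCol (1 : Matrix (Fin m) (Fin m) ℝ) st *ᵥ a))) +
          2 * (p ⬝ᵥ (S.Btilde *ᵥ ((Λ ⊗ₖ (1 : Matrix (Idx n q) (Idx n q) ℝ)) *ᵥ h)) +
            σ ⬝ᵥ (Lw *ᵥ h)) -
          h ⬝ᵥ ((Λ ⊗ₖ Qt⁻¹) *ᵥ h)) +
        (2 * (p ⬝ᵥ (S.A *ᵥ (P *ᵥ d)) + c₁ ⬝ᵥ (P *ᵥ d) + σ ⬝ᵥ (L *ᵥ d)) + d ⬝ᵥ (P *ᵥ d)) := by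
  -- The blocks `p`, `a` and `c₂` all meet `L` and `L_w`; `σ` is their combined coefficient.
  have hB : ∀ v, (p ᵥ* S.B₀) ⬝ᵥ v = p ⬝ᵥ (S.B₀ *ᵥ v) := fun v => (dotProduct_mulVec _ _ _).symm
  have e1 : a ⬝ᵥ ((kronCol (1 : Matrix (Fin m) (Fin m) ℝ) st)ᵀ *ᵥ (Lwᵀ *ᵥ a)) =
      a ⬝ᵥ (Lw *ᵥ (kronCol (1 : Matrix (Fin m) (Fin m) ℝ) st *ᵥ a)) := by
    rw [mulVec_mulVec, ← transpose_mul, mulVec_transpose, dotProduct_comm, ← dotProduct_mulVec,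
      mulVec_mulVec]
  have e2 : a ⬝ᵥ ((kronCol (1 : Matrix (Fin m) (Fin m) ℝ) st)ᵀ *ᵥ
      ((fromRows (0 : Matrix (Idx n q) (Fin m × Idx n q) ℝ) Lw)ᵀ *ᵥ Sum.elim c₁ c₂)) =
      c₂ ⬝ᵥ (Lw *ᵥ (kronCol (1 : Matrix (Fin m) (Fin m) ℝ) st *ᵥ a)) := by
    rw [mulVec_mulVec, ← transpose_mul, mulVec_transpose, dotProduct_comm, ← dotProduct_mulVec,
      ← mulVec_mulVec, fromRows_mulVec, sumElim_dotProduct_sumElim]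
    simp
  subst hσ
  rw [stabilityMatrix]
  simp only [symBlocks_quad, fromCols_mulVec_sumElim, kronCol_eq_mul Λ st]
  simp only [add_mulVec, sub_mulVec, neg_mulVec, ← mulVec_mulVec, dotProduct_add, dotProduct_sub,
    dotProduct_neg, add_dotProduct, hB, e1, e2, fromRows_mulVec, sumElim_dotProduct_sumElim,
    zero_mulVec, dotProduct_zero, smul_mulVec, one_mulVec, dotProduct_smul, smul_eq_mul,
    fromBlocks_mulVec, Sum.elim_comp_inl, Sum.elim_comp_inr]
  ring

/-! ### The dual multiplier condition -/

/-- A kernel vector `(x, t)` satisfies `xᵀQx = r t²`, where the two sides have opposite signs. -/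
lemma isUnit_zMatrix {ι : Type*} [Fintype ι] [DecidableEq ι] {Q : Matrix ι ι ℝ} {s : ι → ℝ}
    {r : ℝ} (hQ : (-Q).PosDef) (hr : 0 < r) : IsUnit (zMatrix Q s r) := by
  rw [← mulVec_injective_iff_isUnit]
  refine (injective_iff_map_eq_zero (zMatrix Q s r).mulVecLin).2 fun w hw => ?_
  obtain ⟨x, t, rfl⟩ : ∃ (x : ι → ℝ) (t : Unit → ℝ), w = Sum.elim x t :=
    ⟨w ∘ Sum.inl, w ∘ Sum.inr, (Sum.elim_comp_inl_inr w).symm⟩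
  rw [mulVecLin_apply, zMatrix, fromBlocks_mulVec] at hw
  have h1 : ∀ k, (Q *ᵥ x) k + s k * t () = 0 := fun k => by
    simpa [mulVec, dotProduct] using congrFun hw (Sum.inl k)
  have h2 : s ⬝ᵥ x + r * t () = 0 := by
    simpa [mulVec, dotProduct] using congrFun hw (Sum.inr ())
  have h3 : x ⬝ᵥ (Q *ᵥ x) + (s ⬝ᵥ x) * t () = 0 := by
    have : ∑ k, x k * ((Q *ᵥ x) k + s k * t ()) = 0 := by simp [h1]
    rw [← this]
    simp only [dotProduct, Finset.sum_mul, ← Finset.sum_add_distrib]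
    exact Finset.sum_congr rfl fun k _ => by ring
  have hx : x = 0 := by
    by_contra hx
    have := hQ.dotProduct_mulVec_pos hx
    simp only [star_trivial, neg_mulVec, dotProduct_neg] at this
    rw [eq_neg_of_add_eq_zero_left h2] at h3
    nlinarith [mul_nonneg hr.le (sq_nonneg (t ()))]
  have ht : t () = 0 := by
    subst hx
    simpa [hr.ne'] using h2
  subst hx
  ext i
  rcases i with i | i
  · rfl
  · exact ht

/-- Needed so that `Q̃⁻¹` in the stability matrix is a genuine inverse. If `Q̃v = 0`, the inverse
block matrix sends `(v, 0)` to some `(0, t)`, hence `(v, 0) = (t s, t r)`, and `r ≠ 0` forces `t =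
0` and `v = 0`. -/
lemma isUnit_Qinv {ι : Type*} [Fintype ι] [DecidableEq ι] {Q : Matrix ι ι ℝ} {s : ι → ℝ}
    {r : ℝ} (hQ : (-Q).PosDef) (hr : 0 < r) : IsUnit (Qinv Q s r) := by
  rw [← mulVec_injective_iff_isUnit]
  refine (injective_iff_map_eq_zero (Qinv Q s r).mulVecLin).2 fun v hv => ?_
  rw [mulVecLin_apply] at hv
  have hZ := isUnit_zMatrix (s := s) hQ hr
  have hdet := (isUnit_iff_isUnit_det _).1 hZ
  obtain ⟨t, ht⟩ : ∃ t : Unit → ℝ,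
      (zMatrix Q s r)⁻¹ *ᵥ Sum.elim v (0 : Unit → ℝ) = Sum.elim (0 : ι → ℝ) t := by
    refine ⟨(zMatrix Q s r)⁻¹.toBlocks₂₁ *ᵥ v, ?_⟩
    conv_lhs => rw [← fromBlocks_toBlocks (zMatrix Q s r)⁻¹, fromBlocks_mulVec]
    simp only [Sum.elim_comp_inl, Sum.elim_comp_inr, mulVec_zero, add_zero]
    rw [← hv, Qinv]
  have h : Sum.elim v (0 : Unit → ℝ) = zMatrix Q s r *ᵥ Sum.elim (0 : ι → ℝ) t := by
    rw [← ht, mulVec_mulVec, mul_nonsing_inv _ hdet, one_mulVec]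
  rw [zMatrix, fromBlocks_mulVec] at h
  have h0 : t () = 0 := by
    have := congrFun h (Sum.inr ())
    simpa [mulVec, dotProduct, hr.ne'] using this
  ext k
  have := congrFun h (Sum.inl k)
  simpa [mulVec, dotProduct, h0] using this

/-- Cauchy–Schwarz for the dual pair `P`, `P⁻¹`, from nonnegativity of the `P`-form at `v - (ψ·v)
P⁻¹ψ`. -/
lemma sq_dotProduct_le_of_inv {ι : Type*} [Fintype ι] [DecidableEq ι] {P : Matrix ι ι ℝ}
    (hP : P.PosDef) {ψ : ι → ℝ} (hψ : ψ ⬝ᵥ (P⁻¹ *ᵥ ψ) ≤ 1) (v : ι → ℝ) :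
    (ψ ⬝ᵥ v) ^ 2 ≤ v ⬝ᵥ (P *ᵥ v) := by
  have hdet := (isUnit_iff_isUnit_det _).1 hP.isUnit
  have hPP : P *ᵥ (P⁻¹ *ᵥ ψ) = ψ := by
    rw [mulVec_mulVec, mul_nonsing_inv _ hdet, one_mulVec]
  have hsymm : (P⁻¹ *ᵥ ψ) ⬝ᵥ (P *ᵥ v) = ψ ⬝ᵥ v := by
    have hPt : Pᵀ = P := by simpa using hP.isHermitian.eq
    rw [dotProduct_mulVec, ← mulVec_transpose, hPt, hPP]
  have h := hP.posSemidef.dotProduct_mulVec_nonneg (v - (ψ ⬝ᵥ v) • (P⁻¹ *ᵥ ψ))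
  simp only [star_trivial, mulVec_sub, mulVec_smul, hPP, dotProduct_sub, sub_dotProduct,
    dotProduct_smul, smul_dotProduct, smul_eq_mul, hsymm, dotProduct_comm v ψ,
    dotProduct_comm (P⁻¹ *ᵥ ψ) ψ] at h
  nlinarith [mul_nonneg (sq_nonneg (ψ ⬝ᵥ v)) (sub_nonneg.2 hψ)]

/-- The dual form of the quadratic inequality describing the set that contains the lifted state. -/
def dualForm {ι : Type*} (Qt : Matrix ι ι ℝ) (st : ι → ℝ) (rt : ℝ) (ψ : ι → ℝ) : Matrix ι ι ℝ :=
  rt • vecMulVec ψ ψ - vecMulVec st ψ - vecMulVec ψ st + Qt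

/-- Testing the invariance inequality on `(ψ·v, v)` gives `ν vᵀHv ≤ (ψ·v)² - vᵀPv` for the dual form
`H`, and Cauchy–Schwarz makes the right side nonpositive. -/
lemma neg_dualForm_posSemidef {ι : Type*} [Fintype ι] [DecidableEq ι] {Qt : Matrix ι ι ℝ}
    {st : ι → ℝ} {rt ν : ℝ} {P : Matrix ι ι ℝ} (hP : P.PosDef) (hν : 0 < ν)
    (hinv : (-invarianceMatrix Qt st rt P ν).PosSemidef) {ψ : ι → ℝ}
    (hψ : ψ ⬝ᵥ (P⁻¹ *ᵥ ψ) ≤ 1) : (-dualForm Qt st rt ψ).PosSemidef := by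
  have hPt : Pᵀ = P := by simpa using hP.isHermitian.eq
  have hQt : Qtᵀ = Qt := by
    have h := hinv.isHermitian.eq
    ext i j
    have h1 := congrFun (congrFun h (Sum.inr i)) (Sum.inr j)
    have h2 := congrFun (congrFun hPt i) j
    simp only [invarianceMatrix, symBlocks, conjTranspose_apply, Matrix.neg_apply, fromBlocks_apply₂₂,
      Matrix.add_apply, Matrix.smul_apply, smul_eq_mul, star_trivial, transpose_apply] at h1 h2
    rw [transpose_apply]
    rw [h2] at h1
    exact mul_left_cancel₀ hν.ne' (by linarith)
  refine .of_dotProduct_mulVec_nonneg ?_ fun v => ?_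
  · rw [IsHermitian, conjTranspose_eq_transpose_of_trivial]
    simp only [dualForm, transpose_neg, transpose_add, transpose_sub, transpose_smul,
      transpose_vecMulVec, hQt]
    abel
  · have h := hinv.dotProduct_mulVec_nonneg (Sum.elim (fun _ => ψ ⬝ᵥ v) v)
    have hCS := sq_dotProduct_le_of_inv hP hψ v
    rw [invarianceMatrix, star_trivial, neg_mulVec, dotProduct_neg, symBlocks_quad] at h
    have e1 : (fun _ : Unit => ψ ⬝ᵥ v) ⬝ᵥ
        ((Matrix.of fun _ _ => ν * rt - 1 : Matrix Unit Unit ℝ) *ᵥ fun _ => ψ ⬝ᵥ v) =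
        (ν * rt - 1) * (ψ ⬝ᵥ v) ^ 2 := by
      simp [mulVec, dotProduct]; ring
    have e2 : (fun _ : Unit => ψ ⬝ᵥ v) ⬝ᵥ ((-(ν • replicateRow Unit st)) *ᵥ v) =
        -(ν * (ψ ⬝ᵥ v) * (st ⬝ᵥ v)) := by
      have : replicateRow Unit st *ᵥ v = fun _ => st ⬝ᵥ v := rfl
      rw [neg_mulVec, smul_mulVec, this, dotProduct_neg, dotProduct_smul]
      simp [mul_assoc]
    rw [e1, e2] at h
    simp only [add_mulVec, smul_mulVec, dotProduct_add, dotProduct_smul, smul_eq_mul] at h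
    simp only [star_trivial, dualForm, neg_mulVec, add_mulVec, sub_mulVec, smul_mulVec,
      vecMulVec_mulVec, dotProduct_neg, dotProduct_add, dotProduct_sub, dotProduct_smul,
      smul_eq_mul, op_smul_eq_smul, dotProduct_comm v ψ, dotProduct_comm v st]
    refine le_of_mul_le_mul_left (a := ν) ?_ hν
    rw [mul_zero]
    linarith

/-- With `a = γ(I ⊗ ψ)` and `h = (I ⊗ Q̃)γ`, the terms in `a` and `h` collapse to `γᵀ(Λ ⊗ H)γ`. A
Kronecker product of positive semidefinite matrices is positive semidefinite, and `-H` is one. -/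
lemma multiplier_nonpos {ι κ : Type*} [Fintype ι] [DecidableEq ι] [Fintype κ] [DecidableEq κ]
    {Qt : Matrix ι ι ℝ} {st : ι → ℝ} {rt : ℝ} {ψ : ι → ℝ} {Λ : Matrix κ κ ℝ} (hΛ : Λ.PosDef)
    (hQt : IsUnit Qt) (hH : (-dualForm Qt st rt ψ).PosSemidef) (γ : κ × ι → ℝ) :
    rt * ((γ ᵥ* kronCol (1 : Matrix κ κ ℝ) ψ) ⬝ᵥ (Λ *ᵥ (γ ᵥ* kronCol (1 : Matrix κ κ ℝ) ψ))) -
      2 * (γ ⬝ᵥ ((Λ ⊗ₖ (1 : Matrix ι ι ℝ)) *ᵥ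
        (kronCol (1 : Matrix κ κ ℝ) st *ᵥ (γ ᵥ* kronCol (1 : Matrix κ κ ℝ) ψ)))) +
      2 * (γ ⬝ᵥ ((Λ ⊗ₖ (1 : Matrix ι ι ℝ)) *ᵥ (((1 : Matrix κ κ ℝ) ⊗ₖ Qt) *ᵥ γ))) -
      (((1 : Matrix κ κ ℝ) ⊗ₖ Qt) *ᵥ γ) ⬝ᵥ
        ((Λ ⊗ₖ Qt⁻¹) *ᵥ (((1 : Matrix κ κ ℝ) ⊗ₖ Qt) *ᵥ γ)) ≤ 0 := by
  have hdet := (isUnit_iff_isUnit_det _).1 hQt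
  have hΛt : Λᵀ = Λ := by simpa using hΛ.isHermitian.eq
  have hQtt : Qtᵀ = Qt := by
    have h : (dualForm Qt st rt ψ)ᵀ = dualForm Qt st rt ψ := by
      simpa using hH.isHermitian.eq
    simp only [dualForm, transpose_add, transpose_sub, transpose_smul, transpose_vecMulVec] at h
    have h' : (rt • vecMulVec ψ ψ - vecMulVec ψ st - vecMulVec st ψ) + Qtᵀ =
      (rt • vecMulVec ψ ψ - vecMulVec ψ st - vecMulVec st ψ) + Qt := by
        rw [h]; abel
    exact add_left_cancel h'
  have hmul : ∀ v : ι → ℝ, kronCol (1 : Matrix κ κ ℝ) v * (kronCol (1 : Matrix κ κ ℝ) ψ)ᵀ =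
      (1 : Matrix κ κ ℝ) ⊗ₖ vecMulVec v ψ := fun v => by
    ext ⟨i, k⟩ ⟨j, l⟩
    simp [kronCol_apply, Matrix.mul_apply, Matrix.one_apply, vecMulVec_apply]
  have hψψ : kronCol (1 : Matrix κ κ ℝ) ψ * Λ * (kronCol (1 : Matrix κ κ ℝ) ψ)ᵀ =
      Λ ⊗ₖ vecMulVec ψ ψ := by
    ext ⟨i, k⟩ ⟨j, l⟩
    simp [kronCol_apply, Matrix.mul_apply, Matrix.one_apply, vecMulVec_apply]
    ring
  have t1 : (γ ᵥ* kronCol (1 : Matrix κ κ ℝ) ψ) ⬝ᵥ (Λ *ᵥ (γ ᵥ* kronCol (1 : Matrix κ κ ℝ) ψ)) =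
      γ ⬝ᵥ ((Λ ⊗ₖ vecMulVec ψ ψ) *ᵥ γ) := by
    rw [← dotProduct_mulVec, ← mulVec_transpose (kronCol _ ψ) γ, mulVec_mulVec, mulVec_mulVec,
      hψψ]
  have t2 : γ ⬝ᵥ ((Λ ⊗ₖ (1 : Matrix ι ι ℝ)) *ᵥ
        (kronCol (1 : Matrix κ κ ℝ) st *ᵥ (γ ᵥ* kronCol (1 : Matrix κ κ ℝ) ψ))) =
      γ ⬝ᵥ ((Λ ⊗ₖ vecMulVec st ψ) *ᵥ γ) := by
    rw [← mulVec_transpose (kronCol _ ψ) γ, mulVec_mulVec, mulVec_mulVec,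
      Matrix.mul_assoc, hmul, ← mul_kronecker_mul, Matrix.mul_one, Matrix.one_mul]
  have t2' : γ ⬝ᵥ ((Λ ⊗ₖ vecMulVec st ψ) *ᵥ γ) = γ ⬝ᵥ ((Λ ⊗ₖ vecMulVec ψ st) *ᵥ γ) := by
    rw [dotProduct_mulVec, ← mulVec_transpose, dotProduct_comm, ← kroneckerMap_transpose,
      transpose_vecMulVec, hΛt]
  have t3 : γ ⬝ᵥ ((Λ ⊗ₖ (1 : Matrix ι ι ℝ)) *ᵥ (((1 : Matrix κ κ ℝ) ⊗ₖ Qt) *ᵥ γ)) =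
      γ ⬝ᵥ ((Λ ⊗ₖ Qt) *ᵥ γ) := by
    rw [mulVec_mulVec, ← mul_kronecker_mul, Matrix.mul_one, Matrix.one_mul]
  have t4 : (((1 : Matrix κ κ ℝ) ⊗ₖ Qt) *ᵥ γ) ⬝ᵥ
        ((Λ ⊗ₖ Qt⁻¹) *ᵥ (((1 : Matrix κ κ ℝ) ⊗ₖ Qt) *ᵥ γ)) = γ ⬝ᵥ ((Λ ⊗ₖ Qt) *ᵥ γ) := by
    rw [mulVec_mulVec, ← mul_kronecker_mul, Matrix.mul_one, nonsing_inv_mul _ hdet,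
      ← vecMul_transpose, ← kroneckerMap_transpose, hQtt, transpose_one, ← dotProduct_mulVec,
      mulVec_mulVec, ← mul_kronecker_mul, Matrix.mul_one, Matrix.one_mul]
  rw [t1, t2, t3, t4]
  have h := (hΛ.posSemidef.kronecker hH).dotProduct_mulVec_nonneg γ
  have hexp : Λ ⊗ₖ (-dualForm Qt st rt ψ) = -(rt • (Λ ⊗ₖ vecMulVec ψ ψ) - Λ ⊗ₖ vecMulVec st ψ -
      Λ ⊗ₖ vecMulVec ψ st + Λ ⊗ₖ Qt) := by
    ext ⟨i, k⟩ ⟨j, l⟩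
    simp [dualForm]
    ring
  rw [hexp] at h
  simp only [star_trivial, neg_mulVec, add_mulVec, sub_mulVec, smul_mulVec, dotProduct_neg,
    dotProduct_add, dotProduct_sub, dotProduct_smul, smul_eq_mul, ← t2'] at h
  linarith

/-! ### Consequences of the stability condition -/

/-- Eliminating the two multiplier blocks of the stability condition at a lifted state `ψ`. -/
lemma stabilityMatrix_quad_le {n q m : ℕ} {S : Surrogate n q m} {cx cu : ℝ}
    {Qt : Matrix (Idx n q) (Idx n q) ℝ} {st : Idx n q → ℝ} {rt : ℝ}
    {P : Matrix (Idx n q) (Idx n q) ℝ} {L : Matrix (Fin m) (Idx n q) ℝ}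
    {Lw : Matrix (Fin m) (Fin m × Idx n q) ℝ} {Λ : Matrix (Fin m) (Fin m) ℝ} {τ : ℝ}
    (hΛ : Λ.PosDef) (hQt : IsUnit Qt) {ψ : Idx n q → ℝ}
    (hH : (-dualForm Qt st rt ψ).PosSemidef) (p c₁ d : Idx n q → ℝ) (c₂ σ : Fin m → ℝ)
    (hσ : σ ᵥ* (1 - Lw * kronCol Λ⁻¹ ψ) =
      p ᵥ* (S.B₀ + S.Btilde * kronCol (1 : Matrix (Fin m) (Fin m) ℝ) ψ) + c₂) :
    ∃ (a : Fin m → ℝ) (h : Fin m × Idx n q → ℝ), σ = p ᵥ* S.B₀ + a + c₂ ∧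
      Sum.elim p (Sum.elim a (Sum.elim (Sum.elim c₁ c₂) (Sum.elim d h))) ⬝ᵥ
        (stabilityMatrix S cx cu Qt st rt P L Lw Λ τ *ᵥ
          Sum.elim p (Sum.elim a (Sum.elim (Sum.elim c₁ c₂) (Sum.elim d h)))) ≤
      p ⬝ᵥ (P *ᵥ p) - τ * (p ⬝ᵥ p) +
        τ / 2 * ((cx ^ 2)⁻¹ * (c₁ ⬝ᵥ c₁) + (cu ^ 2)⁻¹ * (c₂ ⬝ᵥ c₂)) +
        (2 * (p ⬝ᵥ (S.A *ᵥ (P *ᵥ d)) + c₁ ⬝ᵥ (P *ᵥ d) + σ ⬝ᵥ (L *ᵥ d)) + d ⬝ᵥ (P *ᵥ d)) := by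
  have hdet := (isUnit_iff_isUnit_det _).1 hΛ.isUnit
  -- Putting `Λ⁻¹ ⊗ I` behind `L_w` lets both cross terms, with `B̃(Λ ⊗ I)` and with `L_w`, factor
  -- as `γ` against `Λ ⊗ I`.
  set γ : Fin m × Idx n q → ℝ :=
    p ᵥ* S.Btilde + (σ ᵥ* Lw) ᵥ* (Λ⁻¹ ⊗ₖ (1 : Matrix (Idx n q) (Idx n q) ℝ)) with hγ
  have hγΛ : ∀ v, p ⬝ᵥ (S.Btilde *ᵥ ((Λ ⊗ₖ (1 : Matrix (Idx n q) (Idx n q) ℝ)) *ᵥ v)) +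
      σ ⬝ᵥ (Lw *ᵥ v) = γ ⬝ᵥ ((Λ ⊗ₖ (1 : Matrix (Idx n q) (Idx n q) ℝ)) *ᵥ v) := fun v => by
    rw [hγ, add_dotProduct, ← dotProduct_mulVec, ← dotProduct_mulVec, ← dotProduct_mulVec,
      mulVec_mulVec v (Λ⁻¹ ⊗ₖ _), ← mul_kronecker_mul, nonsing_inv_mul _ hdet, Matrix.one_mul,
      one_kronecker_one, one_mulVec]
  have ha : σ = p ᵥ* S.B₀ + γ ᵥ* kronCol (1 : Matrix (Fin m) (Fin m) ℝ) ψ + c₂ := by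
    rw [vecMul_sub, vecMul_one, vecMul_add, sub_eq_iff_eq_add] at hσ
    rw [hγ, add_vecMul, vecMul_vecMul, vecMul_vecMul, vecMul_vecMul,
      ← kronCol_eq_mul]
    conv_lhs => rw [hσ]
    abel
  refine ⟨γ ᵥ* kronCol (1 : Matrix (Fin m) (Fin m) ℝ) ψ,
    ((1 : Matrix (Fin m) (Fin m) ℝ) ⊗ₖ Qt) *ᵥ γ, ha, ?_⟩
  rw [stabilityMatrix_quad _ _ _ _ _ _ _ _ _ _ _ _ _ _ _ _ _ _ ha, hγΛ, hγΛ]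
  have := multiplier_nonpos hΛ hQt hH γ
  linarith

/-- For a left null vector `σ`, the test vector with `p`, `c` and `d` zero has `a = σ` and
nonpositive quadratic form, so positive definiteness gives `σ = 0`. -/
lemma isUnit_gain_of_stability {n q m : ℕ} {S : Surrogate n q m} {cx cu : ℝ}
    {Qt : Matrix (Idx n q) (Idx n q) ℝ} {st : Idx n q → ℝ} {rt : ℝ}
    {P : Matrix (Idx n q) (Idx n q) ℝ} {L : Matrix (Fin m) (Idx n q) ℝ}
    {Lw : Matrix (Fin m) (Fin m × Idx n q) ℝ} {Λ : Matrix (Fin m) (Fin m) ℝ} {τ : ℝ}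
    (hM : (stabilityMatrix S cx cu Qt st rt P L Lw Λ τ).PosDef)
    (hΛ : Λ.PosDef) (hQt : IsUnit Qt) {ψ : Idx n q → ℝ}
    (hH : (-dualForm Qt st rt ψ).PosSemidef) : IsUnit (1 - Lw * kronCol Λ⁻¹ ψ) := by
  rw [← vecMul_injective_iff_isUnit]
  refine (injective_iff_map_eq_zero (1 - Lw * kronCol Λ⁻¹ ψ).vecMulLinear).2 fun σ hσ => ?_
  rw [vecMulLinear_apply] at hσ
  obtain ⟨a, h, ha, hle⟩ := stabilityMatrix_quad_le (S := S) (cx := cx) (cu := cu) (P := P)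
    (L := L) (τ := τ) hΛ hQt hH 0 0 0 0 σ (by rw [hσ]; simp)
  by_contra hne
  have hpos := hM.dotProduct_mulVec_pos
    (x := Sum.elim 0 (Sum.elim a (Sum.elim (Sum.elim 0 0) (Sum.elim 0 h)))) (fun h0 => hne (by
      rw [ha]
      ext i
      simpa using congrFun h0 (Sum.inr (Sum.inl i))))
  rw [star_trivial] at hpos
  simp only [mulVec_zero, dotProduct_zero] at hle
  linarith

/-- The decrease of `ψᵀ P⁻¹ ψ` along the perturbed surrogate dynamics. -/
lemma exists_decrease_of_stability {n q m : ℕ} {S : Surrogate n q m} {cx cu : ℝ}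
    (hcx : 0 < cx) (hcu : 0 < cu)
    {Qt : Matrix (Idx n q) (Idx n q) ℝ} {st : Idx n q → ℝ} {rt : ℝ}
    {P : Matrix (Idx n q) (Idx n q) ℝ} {L : Matrix (Fin m) (Idx n q) ℝ}
    {Lw : Matrix (Fin m) (Fin m × Idx n q) ℝ} {Λ : Matrix (Fin m) (Fin m) ℝ} {τ : ℝ}
    (hM : (stabilityMatrix S cx cu Qt st rt P L Lw Λ τ).PosDef) (hP : P.PosDef)
    (hΛ : Λ.PosDef) (hτ : 0 < τ) (hQt : IsUnit Qt) :
    ∃ ε : ℝ, 0 < ε ∧ ∀ (ψ ψ' e : Idx n q → ℝ) (u : Fin m → ℝ),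
      (-dualForm Qt st rt ψ).PosSemidef →
      (1 - Lw * kronCol Λ⁻¹ ψ) *ᵥ u = L *ᵥ (P⁻¹ *ᵥ ψ) →
      ψ' = S.A *ᵥ ψ + S.B₀ *ᵥ u +
        S.Btilde *ᵥ (kronCol (1 : Matrix (Fin m) (Fin m) ℝ) ψ *ᵥ u) + e →
      e ⬝ᵥ e ≤ 2 * (cx ^ 2 * (ψ ⬝ᵥ ψ) + cu ^ 2 * (u ⬝ᵥ u)) →
      ψ' ⬝ᵥ (P⁻¹ *ᵥ ψ') + ε * (ψ ⬝ᵥ ψ + u ⬝ᵥ u) ≤ ψ ⬝ᵥ (P⁻¹ *ᵥ ψ) := by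
  obtain ⟨ε₀, hε₀, hlow⟩ := exists_pos_mul_dotProduct_le hM
  -- These weights maximize `2k - (τ/2) c⁻² k²`. The maximum is again `k`, so the gain is `k₁‖ψ‖² +
  -- k₂‖u‖²`, exactly the bound on `‖e‖²/τ`.
  set k₁ : ℝ := 2 * cx ^ 2 / τ with hk₁
  set k₂ : ℝ := 2 * cu ^ 2 / τ with hk₂
  have hk₁p : 0 < k₁ := by positivity
  have hk₂p : 0 < k₂ := by positivity
  refine ⟨ε₀ * min (k₁ ^ 2) (k₂ ^ 2), by positivity, fun ψ ψ' e u hH hu hψ' he => ?_⟩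
  have hdet := (isUnit_iff_isUnit_det _).1 hP.isUnit
  have hPP : ∀ v, P *ᵥ (P⁻¹ *ᵥ v) = v := fun v => by
    rw [mulVec_mulVec, mul_nonsing_inv _ hdet, one_mulVec]
  have hD := isUnit_gain_of_stability hM hΛ hQt hH
  have hDdet := (isUnit_iff_isUnit_det _).1 hD
  set p := P⁻¹ *ᵥ ψ' with hp
  -- Solving for `σ` with this right side turns `σ·L P⁻¹ψ` into `p·(B₀ + B̃(I ⊗ ψ))u + k₂‖u‖²`, by
  -- the equation defining `u`.
  set b : Fin m → ℝ := p ᵥ* (S.B₀ + S.Btilde * kronCol (1 : Matrix (Fin m) (Fin m) ℝ) ψ) +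
    k₂ • u with hb
  obtain ⟨σ, hσ⟩ : ∃ σ : Fin m → ℝ, σ ᵥ* (1 - Lw * kronCol Λ⁻¹ ψ) = b :=
    ⟨b ᵥ* (1 - Lw * kronCol Λ⁻¹ ψ)⁻¹, by
      rw [vecMul_vecMul, nonsing_inv_mul _ hDdet, vecMul_one]⟩
  obtain ⟨a, h, -, hle⟩ := stabilityMatrix_quad_le (S := S) (cx := cx) (cu := cu) (P := P)
    (L := L) (τ := τ) hΛ hQt hH p (k₁ • ψ) (-(P⁻¹ *ᵥ ψ)) (k₂ • u) σ hσ
  have hge := (hlow _).trans hle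
  have hnn : ∀ {κ : Type} [Fintype κ] (v : κ → ℝ), 0 ≤ v ⬝ᵥ v := fun v => by
    simpa using dotProduct_star_self_nonneg v
  have hσL : σ ⬝ᵥ (L *ᵥ (P⁻¹ *ᵥ ψ)) = p ⬝ᵥ (S.B₀ *ᵥ u) +
      p ⬝ᵥ (S.Btilde *ᵥ (kronCol (1 : Matrix (Fin m) (Fin m) ℝ) ψ *ᵥ u)) + k₂ * (u ⬝ᵥ u) := by
    rw [← hu, dotProduct_mulVec, hσ, hb, add_dotProduct, ← dotProduct_mulVec, add_mulVec,
      dotProduct_add, mulVec_mulVec, smul_dotProduct, smul_eq_mul]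
  have hpψ' : p ⬝ᵥ ψ' = p ⬝ᵥ (S.A *ᵥ ψ) + p ⬝ᵥ (S.B₀ *ᵥ u) +
      p ⬝ᵥ (S.Btilde *ᵥ (kronCol (1 : Matrix (Fin m) (Fin m) ℝ) ψ *ᵥ u)) + p ⬝ᵥ e := by
    conv_lhs => rw [hψ']
    simp only [dotProduct_add]
  have hpP : P *ᵥ p = ψ' := hPP ψ'
  simp only [sumElim_dotProduct_sumElim, mulVec_neg, dotProduct_neg, neg_dotProduct, neg_neg, hPP,
    hσL, hpP, hpψ', smul_dotProduct, dotProduct_smul, smul_eq_mul] at hge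
  -- Young's inequality with weight `τ`, absorbed by the `-τ I` in the first block.
  have hpe : 2 * (p ⬝ᵥ e) ≤ τ * (p ⬝ᵥ p) + τ⁻¹ * (e ⬝ᵥ e) := by
    have h1 := hnn (τ • p - e)
    simp only [sub_dotProduct, dotProduct_sub, smul_dotProduct, dotProduct_smul, smul_eq_mul,
      dotProduct_comm e p] at h1
    have h2 : 0 ≤ τ⁻¹ * (τ * (τ * (p ⬝ᵥ p)) - p ⬝ᵥ e * τ - (τ * (p ⬝ᵥ e) - e ⬝ᵥ e)) :=
      mul_nonneg (inv_nonneg.2 hτ.le) (by linarith)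
    have h3 : τ⁻¹ * (τ * (τ * (p ⬝ᵥ p)) - p ⬝ᵥ e * τ - (τ * (p ⬝ᵥ e) - e ⬝ᵥ e)) =
      τ * (p ⬝ᵥ p) - 2 * (p ⬝ᵥ e) + τ⁻¹ * (e ⬝ᵥ e) := by field_simp; ring
    linarith
  have hee : τ⁻¹ * (e ⬝ᵥ e) ≤ k₁ * (ψ ⬝ᵥ ψ) + k₂ * (u ⬝ᵥ u) := by
    calc τ⁻¹ * (e ⬝ᵥ e) ≤ τ⁻¹ * (2 * (cx ^ 2 * (ψ ⬝ᵥ ψ) + cu ^ 2 * (u ⬝ᵥ u))) := by gcongr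
      _ = _ := by rw [hk₁, hk₂]; ring
  have hc₁ : τ / 2 * ((cx ^ 2)⁻¹ * (k₁ * (k₁ * (ψ ⬝ᵥ ψ)))) = k₁ * (ψ ⬝ᵥ ψ) := by
    rw [hk₁]; field_simp
  have hc₂ : τ / 2 * ((cu ^ 2)⁻¹ * (k₂ * (k₂ * (u ⬝ᵥ u)))) = k₂ * (u ⬝ᵥ u) := by
    rw [hk₂]; field_simp
  have hmin : ε₀ * min (k₁ ^ 2) (k₂ ^ 2) * (ψ ⬝ᵥ ψ + u ⬝ᵥ u) ≤
      ε₀ * (k₁ * (k₁ * (ψ ⬝ᵥ ψ)) + k₂ * (k₂ * (u ⬝ᵥ u))) := by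
    rw [mul_assoc]
    refine mul_le_mul_of_nonneg_left ?_ hε₀.le
    have h1 := mul_le_mul_of_nonneg_right (min_le_left (k₁ ^ 2) (k₂ ^ 2)) (hnn ψ)
    have h2 := mul_le_mul_of_nonneg_right (min_le_right (k₁ ^ 2) (k₂ ^ 2)) (hnn u)
    linarith
  have hdrop : ε₀ * (k₁ * (k₁ * (ψ ⬝ᵥ ψ)) + k₂ * (k₂ * (u ⬝ᵥ u))) ≤
      ε₀ * (p ⬝ᵥ p + (a ⬝ᵥ a + (k₁ * (k₁ * (ψ ⬝ᵥ ψ)) + k₂ * (k₂ * (u ⬝ᵥ u)) +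
        ((P⁻¹ *ᵥ ψ) ⬝ᵥ (P⁻¹ *ᵥ ψ) + h ⬝ᵥ h)))) := by
    refine mul_le_mul_of_nonneg_left ?_ hε₀.le
    have := hnn p
    have := hnn a
    have := hnn h
    have := hnn (P⁻¹ *ᵥ ψ)
    linarith
  rw [dotProduct_comm ψ' p, hpψ']
  rw [dotProduct_comm (P⁻¹ *ᵥ ψ) ψ] at hge
  linarith

/-! ### Decrease along the sampled system -/

lemma liftRed_zero {n q : ℕ} {φ : Fin q → E n → ℝ} (hφ0 : ∀ l, φ l 0 = 0) :
    liftRed φ 0 = 0 := by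
  ext k
  rcases k with k | k <;> simp [liftRed, hφ0]

lemma norm_le_norm_liftRed {n q : ℕ} (φ : Fin q → E n → ℝ) (x : E n) : ‖x‖ ≤ ‖liftRed φ x‖ := by
  refine abs_le_of_sq_le_sq' ?_ (norm_nonneg _) |>.2
  rw [EuclideanSpace.real_norm_sq_eq, EuclideanSpace.real_norm_sq_eq, Fintype.sum_sum_type]
  simp only [liftRed, Sum.elim_inl, Sum.elim_inr]
  exact le_add_of_nonneg_right (Finset.sum_nonneg fun _ _ => sq_nonneg _)

lemma norm_lift_sub_lift_zero {n q : ℕ} {φ : Fin q → E n → ℝ} (hφ0 : ∀ l, φ l 0 = 0) (x : E n) :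
    ‖lift φ x - lift φ 0‖ = ‖liftRed φ x‖ := by
  rw [← sq_eq_sq₀ (norm_nonneg _) (norm_nonneg _), EuclideanSpace.real_norm_sq_eq,
    EuclideanSpace.real_norm_sq_eq, Fintype.sum_sum_type]
  simp [lift, liftRed_zero hφ0]

/-- Below the constant observable the surrogate is bilinear: `B̃(I ⊗ ψ)u = ∑ u_i (B̂_i - A)ψ`. -/
lemma Surrogate.K_mulVec_lift {n q m : ℕ} (S : Surrogate n q m) (φ : Fin q → E n → ℝ) (u : E m)
    (x : E n) (k : Idx n q) :
    (S.K u *ᵥ (lift φ x).ofLp) (Sum.inr k) =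
      (S.A *ᵥ (liftRed φ x).ofLp + S.B₀ *ᵥ u.ofLp +
        S.Btilde *ᵥ (kronCol (1 : Matrix (Fin m) (Fin m) ℝ) (liftRed φ x).ofLp *ᵥ u.ofLp)) k := by
  have hlift : (lift φ x).ofLp = Sum.elim (fun _ => 1) (liftRed φ x).ofLp := rfl
  have hkron : kronCol (1 : Matrix (Fin m) (Fin m) ℝ) (liftRed φ x).ofLp *ᵥ u.ofLp =
      fun p => u p.1 * (liftRed φ x) p.2 := by
    ext ⟨i, l⟩
    simp only [mulVec, dotProduct, kronCol_apply, Matrix.one_apply, ite_mul, one_mul, zero_mul]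
    rw [Finset.sum_ite_eq Finset.univ i]
    simp [mul_comm]
  have hB : (S.B₀ *ᵥ u.ofLp) k = ∑ i, u i * S.b i k := by
    simp [Surrogate.B₀, mulVec, dotProduct, mul_comm]
  have hBt : (S.Btilde *ᵥ fun p => u p.1 * (liftRed φ x) p.2) k =
      ∑ i, u i * ((S.Bhat i - S.A) *ᵥ (liftRed φ x).ofLp) k := by
    simp only [Surrogate.Btilde, mulVec, dotProduct, Fintype.sum_prod_type, Matrix.of_apply,
      Finset.mul_sum]
    exact Finset.sum_congr rfl fun i _ => Finset.sum_congr rfl fun l _ => by ring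
  have hK₀ : (S.K₀ *ᵥ (lift φ x).ofLp) (Sum.inr k) = (S.A *ᵥ (liftRed φ x).ofLp) k := by
    rw [hlift, Surrogate.K₀, fromBlocks_mulVec]
    simp
  have hKe : ∀ i, (S.Ke i *ᵥ (lift φ x).ofLp) (Sum.inr k) =
      S.b i k + (S.Bhat i *ᵥ (liftRed φ x).ofLp) k := fun i => by
    rw [hlift, Surrogate.Ke, fromBlocks_mulVec]
    simp [mulVec, dotProduct]
  rw [Surrogate.K, add_mulVec, sum_mulVec, Pi.add_apply, hK₀, Finset.sum_apply, Pi.add_apply,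
    Pi.add_apply, hkron, hB, hBt, add_assoc, ← Finset.sum_add_distrib]
  congr 1
  refine Finset.sum_congr rfl fun i _ => ?_
  rw [smul_mulVec, sub_mulVec, sub_mulVec, Pi.smul_apply, Pi.sub_apply, Pi.sub_apply, hK₀, hKe,
    smul_eq_mul]
  ring

/-- The Lyapunov function `x ↦ Φ̂(x)ᵀ P⁻¹ Φ̂(x)`. -/
noncomputable def lyapunov {n q : ℕ} (φ : Fin q → E n → ℝ) (P : Matrix (Idx n q) (Idx n q) ℝ) (x : E n) : ℝ :=
  (liftRed φ x).ofLp ⬝ᵥ (P⁻¹ *ᵥ (liftRed φ x).ofLp)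

lemma IsFeasible.neg_dualForm_posSemidef {n q m : ℕ} {φ : Fin q → E n → ℝ} {S : Surrogate n q m}
    {cx cu : ℝ} {Q : Matrix (Idx n q) (Idx n q) ℝ} {s : Idx n q → ℝ} {r : ℝ}
    {P : Matrix (Idx n q) (Idx n q) ℝ} {L : Matrix (Fin m) (Idx n q) ℝ}
    {Lw : Matrix (Fin m) (Fin m × Idx n q) ℝ} {Λ : Matrix (Fin m) (Fin m) ℝ} {ν τ : ℝ}
    (h : IsFeasible S cx cu Q s r P L Lw Λ ν τ) {x : E n} (hx : x ∈ roa φ P) :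
    (-dualForm (Qinv Q s r) (sinv Q s r) (rinv Q s r) (liftRed φ x).ofLp).PosSemidef :=
  SafEDMD.neg_dualForm_posSemidef h.posP h.posν h.invariance hx

lemma IsFeasible.isUnit_gainMatrix {n q m : ℕ} {φ : Fin q → E n → ℝ} {S : Surrogate n q m}
    {cx cu : ℝ} {Q : Matrix (Idx n q) (Idx n q) ℝ} {s : Idx n q → ℝ} {r : ℝ}
    {P : Matrix (Idx n q) (Idx n q) ℝ} {L : Matrix (Fin m) (Idx n q) ℝ}
    {Lw : Matrix (Fin m) (Fin m × Idx n q) ℝ} {Λ : Matrix (Fin m) (Fin m) ℝ} {ν τ : ℝ}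
    (h : IsFeasible S cx cu Q s r P L Lw Λ ν τ) (hQ : (-Q).PosDef) (hr : 0 < r) {x : E n}
    (hx : x ∈ roa φ P) : IsUnit (gainMatrix φ Lw Λ x) :=
  isUnit_gain_of_stability h.stability h.posΛ (isUnit_Qinv hQ hr) (h.neg_dualForm_posSemidef hx)

/-- Under the error bound, one sampling step of the controlled system decreases the Lyapunov
function by an amount that controls both the lifted state and the input. -/
lemma IsFeasible.exists_lyapunov_decrease {n q m : ℕ} {f : E n → E n} {g : Fin m → E n → E n}
    {X : Set (E n)} {U : Set (E m)} {Δt : ℝ} {φ : Fin q → E n → ℝ} (hφ0 : ∀ l, φ l 0 = 0)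
    {S : Surrogate n q m} {cx cu : ℝ} (hcx : 0 < cx) (hcu : 0 < cu)
    {Q : Matrix (Idx n q) (Idx n q) ℝ} {s : Idx n q → ℝ} {r : ℝ}
    {P : Matrix (Idx n q) (Idx n q) ℝ} {L : Matrix (Fin m) (Idx n q) ℝ}
    {Lw : Matrix (Fin m) (Fin m × Idx n q) ℝ} {Λ : Matrix (Fin m) (Fin m) ℝ} {ν τ : ℝ}
    (h : IsFeasible S cx cu Q s r P L Lw Λ ν τ) (hQ : (-Q).PosDef) (hr : 0 < r)
    (hS : ErrorBound f g φ X U Δt cx cu S) (hX : roa φ P ⊆ X)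
    (hU : ∀ ξ ∈ roa φ P, controller φ P L Lw Λ ξ ∈ U) :
    ∃ ε : ℝ, 0 < ε ∧ ∀ x ∈ roa φ P,
      lyapunov φ P (trajectory f g (controller φ P L Lw Λ x) x Δt) +
        ε * (‖liftRed φ x‖ ^ 2 + ‖controller φ P L Lw Λ x‖ ^ 2) ≤ lyapunov φ P x := by
  obtain ⟨ε, hε, hdec⟩ := exists_decrease_of_stability hcx hcu h.stability h.posP h.posΛ h.posτ
    (isUnit_Qinv hQ hr)
  refine ⟨ε, hε, fun x hx => ?_⟩
  set u := controller φ P L Lw Λ x with hu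
  set ψ := liftRed φ x with hψ
  set ψ' := liftRed φ (trajectory f g u x Δt) with hψ'
  set e : EuclideanSpace ℝ (Idx n q) := WithLp.toLp 2 (ψ'.ofLp - (S.A *ᵥ ψ.ofLp + S.B₀ *ᵥ u.ofLp +
    S.Btilde *ᵥ (kronCol (1 : Matrix (Fin m) (Fin m) ℝ) ψ.ofLp *ᵥ u.ofLp))) with he
  -- Dropping the component of the constant observable can only decrease the norm of the error.
  have hnorm : ‖e‖ ≤ cx * ‖ψ‖ + cu * ‖u‖ := by
    have hb := hS x (hX hx) u (hU x hx)
    rw [norm_lift_sub_lift_zero hφ0] at hb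
    refine le_trans ?_ hb
    refine abs_le_of_sq_le_sq' ?_ (norm_nonneg _) |>.2
    rw [EuclideanSpace.real_norm_sq_eq, EuclideanSpace.real_norm_sq_eq,
      Fintype.sum_sum_type (α₁ := Unit)]
    refine le_add_of_nonneg_of_le (Finset.sum_nonneg fun _ _ => sq_nonneg _) ?_
    refine le_of_eq (Finset.sum_congr rfl fun k _ => ?_)
    have hk := S.K_mulVec_lift φ u x k
    simp only [he, koopman, PiLp.sub_apply, Pi.sub_apply]
    rw [hk]
    rfl
  have hgain : (1 - Lw * kronCol Λ⁻¹ ψ.ofLp) *ᵥ u.ofLp = L *ᵥ (P⁻¹ *ᵥ ψ.ofLp) := by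
    have hunit := (isUnit_iff_isUnit_det _).1 (h.isUnit_gainMatrix hQ hr hx)
    have : u.ofLp = ((gainMatrix φ Lw Λ x)⁻¹ * L * P⁻¹) *ᵥ ψ.ofLp := rfl
    rw [this, mulVec_mulVec, mulVec_mulVec, ← gainMatrix, Matrix.mul_assoc, ← Matrix.mul_assoc,
      mul_nonsing_inv _ hunit, Matrix.one_mul]
  have hfin := hdec ψ.ofLp ψ'.ofLp e.ofLp u.ofLp (h.neg_dualForm_posSemidef hx) hgain
    (by simp [he]) (by
      simp only [dotProduct_self_eq_norm_sq]
      have h0 : 0 ≤ ‖e‖ := norm_nonneg _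
      have h1 : ‖e‖ ^ 2 ≤ (cx * ‖ψ‖ + cu * ‖u‖) ^ 2 := by gcongr
      nlinarith [sq_nonneg (cx * ‖ψ‖ - cu * ‖u‖)])
  simp only [dotProduct_self_eq_norm_sq] at hfin
  exact hfin

end SafEDMD

/-! ### From decrease at the samples to continuous-time stability -/

namespace SafEDMD

/-! ### Growth estimates -/

/-- Inside a ball of radius `ρ` the Lipschitz constant suffices; outside it a bound `B` on the
compact set gives slope `|B|/ρ`. The extra `1` keeps the constant positive. -/
lemma exists_norm_le_mul_norm {E₁ E₂ : Type*} [NormedAddCommGroup E₁] [NormedAddCommGroup E₂]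
    {h : E₁ → E₂} (hc : Continuous h) (h0 : h 0 = 0) {W : Set E₁} (hW : W ∈ 𝓝 (0 : E₁))
    {K : NNReal} (hK : LipschitzOnWith K h W) {X : Set E₁} (hX : IsCompact X) :
    ∃ C : ℝ, 0 < C ∧ ∀ x ∈ X, ‖h x‖ ≤ C * ‖x‖ := by
  obtain ⟨ρ, hρ, hball⟩ := Metric.mem_nhds_iff.1 hW
  obtain ⟨B, hB⟩ := hX.exists_bound_of_continuousOn hc.continuousOn
  refine ⟨K + |B| / ρ + 1, by positivity, fun x hx => ?_⟩
  have hK0 : (0 : ℝ) ≤ K := K.2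
  by_cases hxρ : ‖x‖ < ρ
  · have := hK.norm_sub_le (hball (by simpa using hxρ)) (mem_of_mem_nhds hW)
    rw [h0, sub_zero, sub_zero] at this
    refine this.trans (mul_le_mul_of_nonneg_right ?_ (norm_nonneg _))
    have : 0 ≤ |B| / ρ := by positivity
    linarith
  · have h1 : ‖h x‖ ≤ |B| := (hB x hx).trans (le_abs_self _)
    have h2 : |B| ≤ |B| / ρ * ‖x‖ := by
      rw [div_mul_eq_mul_div, le_div_iff₀ hρ]
      exact mul_le_mul_of_nonneg_left (not_lt.1 hxρ) (abs_nonneg _)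
    nlinarith [norm_nonneg x]

lemma exists_norm_liftRed_le {n q : ℕ} {φ : Fin q → E n → ℝ} (hφ : ∀ l, ContDiff ℝ 1 (φ l))
    (hφ0 : ∀ l, φ l 0 = 0) {X : Set (E n)} (hX : IsCompact X) :
    ∃ C : ℝ, 0 < C ∧ ∀ x ∈ X, ‖liftRed φ x‖ ≤ C * ‖x‖ := by
  have hC : ContDiff ℝ 1 (liftRed φ) := by
    rw [contDiff_euclidean]
    rintro (k | k)
    · exact contDiff_euclidean.1 contDiff_id k
    · exact hφ k
  obtain ⟨K, W, hW, hK⟩ := (hC.contDiffAt (x := 0)).exists_lipschitzOnWith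
  exact exists_norm_le_mul_norm hC.continuous (liftRed_zero hφ0) hW hK hX

/-- Each `g_i` is a difference of two values of `f_c` and hence continuous. Since it is multiplied
by `u_i`, boundedness on `X` suffices, and only the drift needs the Lipschitz bound at the origin.
-/
lemma exists_norm_vectorField_le {n m : ℕ} {f : E n → E n} {g : Fin m → E n → E n}
    (hf0 : f 0 = 0) {X : Set (E n)} (hX : IsCompact X)
    (hcont : Continuous fun p : E n × E m => vectorField f g p.1 p.2)
    {W : Set (E n)} (hW : W ∈ 𝓝 (0 : E n)) {K : NNReal}
    (hK : LipschitzOnWith K (fun x => vectorField f g x 0) W) :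
    ∃ K' M : ℝ, 0 < K' ∧ 0 ≤ M ∧ ∀ x ∈ X, ∀ u, ‖vectorField f g x u‖ ≤ K' * ‖x‖ + M * ‖u‖ := by
  have hv : ∀ u, Continuous fun x => vectorField f g x u := fun u =>
    hcont.comp (Continuous.prodMk continuous_id continuous_const)
  have hv0 : ∀ x, vectorField f g x 0 = f x := fun x => by simp [vectorField]
  have hg : ∀ i, Continuous (g i) := fun i => by
    have h : g i = fun x => vectorField f g x (EuclideanSpace.single i 1) - vectorField f g x 0 := by
      ext1 x
      simp [vectorField, ite_smul]
    rw [h]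
    exact (hv _).sub (hv _)
  obtain ⟨K', hK', hf⟩ := exists_norm_le_mul_norm (hv 0) (by rw [hv0, hf0]) hW hK hX
  choose B hB using fun i => hX.exists_bound_of_continuousOn (hg i).continuousOn
  refine ⟨K', ∑ i, |B i|, hK', by positivity, fun x hx u => ?_⟩
  have h1 := hf x hx
  rw [hv0] at h1
  refine (norm_add_le _ _).trans (add_le_add h1 ?_)
  rw [Finset.sum_mul]
  refine (norm_sum_le _ _).trans (Finset.sum_le_sum fun i _ => ?_)
  rw [norm_smul, mul_comm]
  exact mul_le_mul ((hB i x hx).trans (le_abs_self _)) (PiLp.norm_apply_le u i) (norm_nonneg _)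
    (abs_nonneg _)

/-! ### Solutions for constant inputs -/

section ConstantInput

variable {n m : ℕ} {f : E n → E n} {g : Fin m → E n → E n} {X : Set (E n)} {U : Set (E m)}

lemma FlowInvariant.isSolution_trajectory (hflow : FlowInvariant f g X U) {x₀ : E n}
    (hx : x₀ ∈ X) {u : E m} (hu : u ∈ U) (T : ℝ) :
    IsSolution f g (fun _ => u) x₀ T (trajectory f g u x₀) := by
  obtain ⟨z, hz, -⟩ := (hflow x₀ hx u hu).1
  have h : ∃ z : ℝ → E n, ∀ T, IsSolution f g (fun _ => u) x₀ T z := ⟨z, hz⟩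
  rw [trajectory, dif_pos h]
  exact h.choose_spec T

lemma FlowInvariant.mem_of_isSolution (hflow : FlowInvariant f g X U) {x₀ : E n}
    (hx : x₀ ∈ X) {u : E m} (hu : u ∈ U) {T : ℝ} {z : ℝ → E n}
    (hz : IsSolution f g (fun _ => u) x₀ T z) {t : ℝ} (ht : t ∈ Set.Icc 0 T) : z t ∈ X := by
  obtain ⟨⟨w, hw, hwX⟩, huniq⟩ := hflow x₀ hx u hu
  rw [huniq T z w hz (hw T) ht]
  exact hwX t ht.1

/-- Grönwall applies because the solution stays in `X`, where the linear growth bound holds. -/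
lemma FlowInvariant.norm_le_of_isSolution (hflow : FlowInvariant f g X U) {K M : ℝ} (hK : 0 < K)
    (hM : 0 ≤ M) (hgrowth : ∀ x ∈ X, ∀ u, ‖vectorField f g x u‖ ≤ K * ‖x‖ + M * ‖u‖)
    {x₀ : E n} (hx : x₀ ∈ X) {u : E m} (hu : u ∈ U) {T Δt : ℝ} (hT : T ≤ Δt) {z : ℝ → E n}
    (hz : IsSolution f g (fun _ => u) x₀ T z) {t : ℝ} (ht : t ∈ Set.Icc 0 T) :
    ‖z t‖ ≤ Real.exp (K * Δt) * (‖x₀‖ + M / K * ‖u‖) := by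
  have h := norm_le_gronwallBound_of_norm_deriv_right_le hz.2.1 hz.2.2 (δ := ‖x₀‖)
    (by rw [hz.1]) (fun s hs => hgrowth (z s)
      (hflow.mem_of_isSolution hx hu hz (Set.Ico_subset_Icc_self hs)) u) t ht
  rw [gronwallBound_of_K_ne_0 hK.ne', sub_zero] at h
  have hexp : Real.exp (K * t) ≤ Real.exp (K * Δt) :=
    Real.exp_le_exp.2 (mul_le_mul_of_nonneg_left (ht.2.trans hT) hK.le)
  have hMu : 0 ≤ M / K * ‖u‖ := by positivity
  calc ‖z t‖ ≤ ‖x₀‖ * Real.exp (K * t) + M * ‖u‖ / K * (Real.exp (K * t) - 1) := h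
    _ = ‖x₀‖ * Real.exp (K * t) + M / K * ‖u‖ * (Real.exp (K * t) - 1) := by ring
    _ ≤ ‖x₀‖ * Real.exp (K * Δt) + M / K * ‖u‖ * Real.exp (K * Δt) := by
      gcongr
      linarith
    _ = _ := by ring

end ConstantInput

/-! ### Sampled feedback -/

lemma floor_add_div {Δt : ℝ} (hΔt : 0 < Δt) (k : ℕ) {s : ℝ} (hs : s ∈ Set.Ico 0 Δt) :
    ⌊(k * Δt + s) / Δt⌋₊ = k := by
  rw [Nat.floor_eq_iff (by have := hs.1; positivity), le_div_iff₀ hΔt, div_lt_iff₀ hΔt]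
  constructor <;> nlinarith [hs.1, hs.2]

lemma hasDerivWithinAt_comp_add_left {F : Type*} [NormedAddCommGroup F] [NormedSpace ℝ F]
    {z : ℝ → F} {v : F} {c s : ℝ} (h : HasDerivWithinAt z v (Set.Ici (c + s)) (c + s)) :
    HasDerivWithinAt (fun r => z (c + r)) v (Set.Ici s) s := by
  have h1 : HasDerivWithinAt (fun r : ℝ => c + r) 1 (Set.Ici s) s :=
    ((hasDerivAt_id s).const_add c).hasDerivWithinAt
  have := HasDerivWithinAt.scomp s h h1 (fun r hr => by
    simp only [Set.mem_Ici] at hr ⊢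
    linarith)
  rwa [one_smul] at this

section Sampled

variable {n m : ℕ} {f : E n → E n} {g : Fin m → E n → E n} {μ : E n → E m} {Δt : ℝ}

/-- Between two sampling instants a closed-loop solution solves the system with constant input. -/
lemma IsSolution.restart (hΔt : 0 < Δt) {x₀ : E n} {T : ℝ} {z : ℝ → E n}
    (hz : IsSolution f g (sampleHold μ Δt z) x₀ T z) (k : ℕ) {T' : ℝ} (hT' : T' ≤ Δt)
    (hT : k * Δt + T' ≤ T) :
    IsSolution f g (fun _ => μ (z (k * Δt))) (z (k * Δt)) T' fun s => z (k * Δt + s) := by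
  have hk : 0 ≤ k * Δt := by positivity
  refine ⟨by simp, ?_, fun s hs => ?_⟩
  · refine hz.2.1.comp (by fun_prop) fun s hs => ?_
    exact ⟨by linarith [hs.1], by linarith [hs.2]⟩
  · have h := hz.2.2 (k * Δt + s) ⟨by linarith [hs.1], by linarith [hs.2]⟩
    rw [sampleHold, floor_add_div hΔt k ⟨hs.1, hs.2.trans_le hT'⟩] at h
    exact hasDerivWithinAt_comp_add_left h

/-- The states at the sampling instants. -/
noncomputable def sampledState (f : E n → E n) (g : Fin m → E n → E n) (μ : E n → E m) (Δt : ℝ) (x₀ : E n) :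
    ℕ → E n
  | 0 => x₀
  | k + 1 => trajectory f g (μ (sampledState f g μ Δt x₀ k)) (sampledState f g μ Δt x₀ k) Δt

/-- The closed-loop solution, concatenated from solutions for constant inputs. -/
noncomputable def closedLoop (f : E n → E n) (g : Fin m → E n → E n) (μ : E n → E m) (Δt : ℝ) (x₀ : E n)
    (t : ℝ) : E n :=
  trajectory f g (μ (sampledState f g μ Δt x₀ ⌊t / Δt⌋₊)) (sampledState f g μ Δt x₀ ⌊t / Δt⌋₊)
    (t - ⌊t / Δt⌋₊ * Δt)

lemma isSolution_closedLoop (hΔt : 0 < Δt) {X : Set (E n)} {U : Set (E m)}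
    (hflow : FlowInvariant f g X U) {x₀ : E n} (hX : ∀ k, sampledState f g μ Δt x₀ k ∈ X)
    (hU : ∀ k, μ (sampledState f g μ Δt x₀ k) ∈ U) (T : ℝ) :
    IsSolution f g (sampleHold μ Δt (closedLoop f g μ Δt x₀)) x₀ T (closedLoop f g μ Δt x₀) := by
  set ξ := sampledState f g μ Δt x₀ with hξ
  set z := closedLoop f g μ Δt x₀ with hz
  have hsol : ∀ k T, IsSolution f g (fun _ => μ (ξ k)) (ξ k) T (trajectory f g (μ (ξ k)) (ξ k)) :=
    fun k T => hflow.isSolution_trajectory (hX k) (hU k) T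
  have hpiece : ∀ (k : ℕ) (s : ℝ), s ∈ Set.Ico 0 Δt →
      z (k * Δt + s) = trajectory f g (μ (ξ k)) (ξ k) s := fun k s hs => by
    simp only [hz, closedLoop, floor_add_div hΔt k hs, add_sub_cancel_left]
    rfl
  have hnode : ∀ k : ℕ, z (k * Δt) = ξ k := fun k => by
    have := hpiece k 0 ⟨le_rfl, hΔt⟩
    rw [add_zero] at this
    rw [this, (hsol k 0).1]
  -- At the right endpoint the next piece takes over, but it starts at the end value of the current
  -- one, so the formula survives.
  have hpiece' : ∀ (k : ℕ) (s : ℝ), s ∈ Set.Icc 0 Δt →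
      z (k * Δt + s) = trajectory f g (μ (ξ k)) (ξ k) s := fun k s hs => by
    rcases hs.2.lt_or_eq with h | h
    · exact hpiece k s ⟨hs.1, h⟩
    · have := hnode (k + 1)
      rw [h]
      push_cast at this
      rw [add_mul, one_mul] at this
      rw [this]
      rfl
  have hcontPiece : ∀ k : ℕ, ContinuousOn z (Set.Icc (k * Δt) ((k + 1 : ℕ) * Δt)) := fun k => by
    have hc : ContinuousOn (fun t => trajectory f g (μ (ξ k)) (ξ k) (t - k * Δt))
        (Set.Icc (k * Δt) ((k + 1 : ℕ) * Δt)) := by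
      refine (hsol k Δt).2.1.comp (by fun_prop) fun t ht => ?_
      obtain ⟨h1, h2⟩ := ht
      push_cast at h2
      exact ⟨by linarith, by linarith⟩
    refine hc.congr fun t ht => ?_
    obtain ⟨h1, h2⟩ := ht
    push_cast at h2
    have := hpiece' k (t - k * Δt) ⟨by linarith, by linarith⟩
    rwa [add_sub_cancel] at this
  have hcontN : ∀ k : ℕ, ContinuousOn z (Set.Icc 0 (k * Δt)) := fun k => by
    induction k with
    | zero => simp
    | succ k ih =>
      have := ih.union_of_isClosed (hcontPiece k) isClosed_Icc isClosed_Icc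
      rwa [Set.Icc_union_Icc_eq_Icc (by positivity) (by push_cast; linarith)] at this
  refine ⟨by simpa [hξ, sampledState] using hnode 0, ?_, fun t ht => ?_⟩
  · obtain ⟨k, hk⟩ := exists_nat_ge (T / Δt)
    exact (hcontN k).mono (Set.Icc_subset_Icc_right ((div_le_iff₀ hΔt).1 hk))
  · set k := ⌊t / Δt⌋₊ with hk
    have h1 : k * Δt ≤ t := (le_div_iff₀ hΔt).1 (Nat.floor_le (div_nonneg ht.1 hΔt.le))
    have h2 : t < k * Δt + Δt := by
      have := (div_lt_iff₀ hΔt).1 (Nat.lt_floor_add_one (t / Δt))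
      linarith
    have hzt : z t = trajectory f g (μ (ξ k)) (ξ k) (t - k * Δt) := rfl
    have hμ : sampleHold μ Δt z t = μ (ξ k) := by
      rw [sampleHold, ← hk, hnode]
    rw [hμ, hzt]
    have hd := (hsol k Δt).2.2 (t - k * Δt) ⟨by linarith, by linarith⟩
    have hd' : HasDerivWithinAt (fun r => trajectory f g (μ (ξ k)) (ξ k) (-(k * Δt) + r))
        (vectorField f g (trajectory f g (μ (ξ k)) (ξ k) (t - k * Δt)) (μ (ξ k))) (Set.Ici t) t := by
      refine hasDerivWithinAt_comp_add_left ?_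
      rwa [neg_add_eq_sub]
    refine hd'.congr_of_eventuallyEq ?_ (by rw [hzt, neg_add_eq_sub])
    -- A right derivative only sees the current piece, even at a sampling instant.
    filter_upwards [Ico_mem_nhdsGE h2] with r hr
    have := hpiece k (r - k * Δt) ⟨by linarith [hr.1], by linarith [hr.2]⟩
    rw [add_sub_cancel] at this
    rw [this, neg_add_eq_sub]

/-- A Lyapunov function that contracts from one sampling instant to the next yields exponential
stability of the continuous-time closed loop. -/
theorem sampledExpStable_of_lyapunov (hΔt : 0 < Δt) {X : Set (E n)} {U : Set (E m)}
    (hflow : FlowInvariant f g X U) {K M : ℝ} (hK : 0 < K) (hM : 0 ≤ M)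
    (hgrowth : ∀ x ∈ X, ∀ u, ‖vectorField f g x u‖ ≤ K * ‖x‖ + M * ‖u‖)
    {R : Set (E n)} (hRX : R ⊆ X) (hRU : ∀ x ∈ R, μ x ∈ U) {κ : ℝ} (hκ : 0 ≤ κ)
    (hμ : ∀ x ∈ R, ‖μ x‖ ≤ κ * ‖x‖) {V : E n → ℝ} {a b θ : ℝ} (ha : 0 < a) (hb : 0 < b)
    (hθ : θ ∈ Set.Ioo (0 : ℝ) 1) (hVa : ∀ x, a * ‖x‖ ^ 2 ≤ V x)
    (hVb : ∀ x ∈ R, V x ≤ b * ‖x‖ ^ 2)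
    (hstep : ∀ x ∈ R, trajectory f g (μ x) x Δt ∈ R ∧ V (trajectory f g (μ x) x Δt) ≤ θ * V x) :
    SampledExpStable f g μ Δt R := by
  obtain ⟨hθ0, hθ1⟩ := hθ
  set G : ℝ := Real.exp (K * Δt) * (1 + M / K * κ) with hG
  have hG0 : 0 < G := by positivity
  -- `V` shrinks by `θ` per period and is comparable to the squared norm, hence the factor `2`.
  set η : ℝ := -Real.log θ / (2 * Δt) with hη
  have hη0 : 0 < η := div_pos (neg_pos.2 (Real.log_neg hθ0 hθ1)) (by positivity)
  set C : ℝ := G * Real.sqrt (b / (a * θ)) with hC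
  refine ⟨max 1 C, η, le_max_left _ _, hη0, fun x₀ hx₀ => ⟨?_, fun T z hz t ht => ?_⟩⟩
  · have hR : ∀ k, sampledState f g μ Δt x₀ k ∈ R := fun k => by
      induction k with
      | zero => exact hx₀
      | succ k ih => exact (hstep _ ih).1
    exact ⟨closedLoop f g μ Δt x₀, isSolution_closedLoop hΔt hflow (fun k => hRX (hR k))
      fun k => hRU _ (hR k)⟩
  · have hnode : ∀ k : ℕ, k * Δt ≤ T → z (k * Δt) ∈ R ∧ V (z (k * Δt)) ≤ θ ^ k * V x₀ := fun k => by
      induction k with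
      | zero =>
        intro _
        simp [hz.1, hx₀]
      | succ k ih =>
        intro hk
        push_cast at hk ⊢
        obtain ⟨hmem, hV⟩ := ih (by linarith)
        have hsol := hz.restart hΔt k le_rfl (by linarith)
        -- Uniqueness for constant inputs forces any closed-loop solution through the same sampled
        -- states.
        have heq : z ((k + 1) * Δt) = trajectory f g (μ (z (k * Δt))) (z (k * Δt)) Δt := by
          have := (hflow _ (hRX hmem) _ (hRU _ hmem)).2 Δt _ _ hsol
            (hflow.isSolution_trajectory (hRX hmem) (hRU _ hmem) Δt) ⟨hΔt.le, le_rfl⟩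
          rw [← this]
          congr 1
          ring
        rw [heq]
        refine ⟨(hstep _ hmem).1, (hstep _ hmem).2.trans ?_⟩
        rw [pow_succ', mul_assoc]
        exact mul_le_mul_of_nonneg_left hV hθ0.le
    set k := ⌊t / Δt⌋₊ with hk
    have h1 : k * Δt ≤ t := (le_div_iff₀ hΔt).1 (Nat.floor_le (div_nonneg ht.1 hΔt.le))
    have h2 : t / Δt < k + 1 := Nat.lt_floor_add_one (t / Δt)
    have h2' : t < k * Δt + Δt := by
      have := (div_lt_iff₀ hΔt).1 h2
      linarith
    obtain ⟨hmem, hV⟩ := hnode k (h1.trans ht.2)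
    have hsol := hz.restart hΔt k (T' := t - k * Δt) (by linarith) (by linarith [ht.2])
    have hinter := hflow.norm_le_of_isSolution hK hM hgrowth (hRX hmem) (hRU _ hmem)
      (Δt := Δt) (by linarith) hsol (t := t - k * Δt) ⟨by linarith, le_rfl⟩
    simp only [add_sub_cancel] at hinter
    have hzt : ‖z t‖ ≤ G * ‖z (k * Δt)‖ := by
      refine hinter.trans ?_
      rw [hG, mul_assoc]
      refine mul_le_mul_of_nonneg_left ?_ (Real.exp_pos _).le
      have : M / K * ‖μ (z (k * Δt))‖ ≤ M / K * (κ * ‖z (k * Δt)‖) :=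
        mul_le_mul_of_nonneg_left (hμ _ hmem) (by positivity)
      linarith
    -- The number of completed periods exceeds `t/Δt - 1`; the missing period costs the factor
    -- `θ⁻¹`.
    have hθk : θ ^ k ≤ θ⁻¹ * Real.exp (-η * t) ^ 2 := by
      rw [← Real.exp_nat_mul]
      have e1 : ((2 : ℕ) : ℝ) * (-η * t) = Real.log θ * (t / Δt) := by
        rw [hη]
        push_cast
        field_simp
      rw [e1, ← Real.rpow_def_of_pos hθ0, ← Real.rpow_neg_one, ← Real.rpow_add hθ0,
        ← Real.rpow_natCast]
      exact Real.rpow_le_rpow_of_exponent_ge hθ0 hθ1.le (by linarith)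
    have hsq : ‖z (k * Δt)‖ ^ 2 ≤ (Real.sqrt (b / (a * θ)) * Real.exp (-η * t) * ‖x₀‖) ^ 2 := by
      rw [mul_pow, mul_pow, Real.sq_sqrt (by positivity)]
      have h3 : a * ‖z (k * Δt)‖ ^ 2 ≤ θ⁻¹ * Real.exp (-η * t) ^ 2 * (b * ‖x₀‖ ^ 2) :=
        calc a * ‖z (k * Δt)‖ ^ 2 ≤ θ ^ k * V x₀ := (hVa _).trans hV
          _ ≤ θ ^ k * (b * ‖x₀‖ ^ 2) := mul_le_mul_of_nonneg_left (hVb _ hx₀) (by positivity)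
          _ ≤ _ := mul_le_mul_of_nonneg_right hθk (by positivity)
      rw [← le_div_iff₀' ha] at h3
      refine h3.trans_eq ?_
      field_simp
    have hnorm := (abs_le_of_sq_le_sq' hsq (by positivity)).2
    calc ‖z t‖ ≤ G * (Real.sqrt (b / (a * θ)) * Real.exp (-η * t) * ‖x₀‖) :=
          hzt.trans (mul_le_mul_of_nonneg_left hnorm hG0.le)
      _ = C * Real.exp (-η * t) * ‖x₀‖ := by rw [hC]; ring
      _ ≤ max 1 C * Real.exp (-η * t) * ‖x₀‖ := by
        gcongr
        exact le_max_right _ _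

end Sampled

end SafEDMD

/-! ### The main theorem -/

open SafEDMD in
theorem mainTheorem4 {n q m : ℕ}
    -- the system
    (f : E n → E n) (g : Fin m → E n → E n) (hf0 : f 0 = 0)
    (X : Set (E n)) (hX : IsCompact X)
    (U : Set (E m)) (hU : IsCompact U) (hU0 : (0 : E m) ∈ interior U)
    (hflow : FlowInvariant f g X U)
    -- continuity and local Lipschitz continuity around the origin
    (hcont : Continuous fun p : E n × E m => vectorField f g p.1 p.2)
    (hLip : ∀ u : E m, ∃ W ∈ 𝓝 (0 : E n), ∃ K : NNReal,
      LipschitzOnWith K (fun x => vectorField f g x u) W)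
    -- the observables
    (φ : Fin q → E n → ℝ) (hφ : ∀ l, ContDiff ℝ 1 (φ l)) (hφ0 : ∀ l, φ l 0 = 0)
    -- data, learned surrogates, and their error bound
    {Ω : Type*} [MeasurableSpace Ω] (Pr : Measure Ω) [IsProbabilityMeasure Pr]
    (Δt : ℝ) (hΔt : 0 < Δt) (x y : Option (Fin m) → ℕ → Ω → E n)
    (hdata : IsData Pr f g X Δt x y)
    (S : ℕ → Ω → Surrogate n q m)
    (hS : ∀ d ω, IsEDMD φ d (fun v j => x v j ω) (fun v j => y v j ω) (S d ω))
    (δ : ℝ) (hδ : δ ∈ Set.Ioo (0 : ℝ) 1) (cx cu : ℝ) (hcx : 0 < cx) (hcu : 0 < cu) (d₀ : ℕ)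
    (hbound : ∀ d ≥ d₀, WithProb Pr (1 - δ) fun ω => ErrorBound f g φ X U Δt cx cu (S d ω))
    -- the set in which the lifted state is kept
    (Q : Matrix (Idx n q) (Idx n q) ℝ) (s : Idx n q → ℝ) (r : ℝ) (hQ : (-Q).PosDef)
    (hr : 0 < r) :
    ∀ d ≥ d₀, WithProb Pr (1 - δ) fun ω =>
      ∀ (P : Matrix (Idx n q) (Idx n q) ℝ) (L : Matrix (Fin m) (Idx n q) ℝ)
        (Lw : Matrix (Fin m) (Fin m × Idx n q) ℝ) (Λ : Matrix (Fin m) (Fin m) ℝ) (ν τ : ℝ),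
        IsFeasible (S d ω) cx cu Q s r P L Lw Λ ν τ →
        roa φ P ⊆ X → (∀ ξ ∈ roa φ P, controller φ P L Lw Λ ξ ∈ U) →
        (∀ ξ ∈ roa φ P, IsUnit (gainMatrix φ Lw Λ ξ)) ∧
          SampledExpStable f g (controller φ P L Lw Λ) Δt (roa φ P) := by
  intro d hd
  obtain ⟨G, hG, hprob, hall⟩ := hbound d hd
  refine ⟨G, hG, hprob, fun ω hω P L Lw Λ ν τ hfeas hRX hRU =>
    ⟨fun ξ hξ => hfeas.isUnit_gainMatrix hQ hr hξ, ?_⟩⟩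
  obtain ⟨ε, hε, hdec⟩ :=
    hfeas.exists_lyapunov_decrease hφ0 hcx hcu hQ hr (hall ω hω) hRX hRU
  obtain ⟨W, hW, K₀, hK₀⟩ := hLip 0
  obtain ⟨K, M, hK, hM, hgrowth⟩ := exists_norm_vectorField_le hf0 hX hcont hW hK₀
  obtain ⟨C, hC, hlift⟩ := exists_norm_liftRed_le hφ hφ0 hX
  obtain ⟨a, ha, hVa⟩ := exists_pos_mul_dotProduct_le hfeas.posP.inv
  obtain ⟨b, hb, hVb⟩ := exists_dotProduct_mulVec_le P⁻¹
  have hlow : ∀ ξ, a * ‖ξ‖ ^ 2 ≤ lyapunov φ P ξ := fun ξ => by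
    have h := hVa (liftRed φ ξ).ofLp
    rw [dotProduct_self_eq_norm_sq] at h
    refine le_trans (mul_le_mul_of_nonneg_left ?_ ha.le) h
    exact pow_le_pow_left₀ (norm_nonneg _) (norm_le_norm_liftRed φ ξ) 2
  have hnonneg : ∀ ξ, 0 ≤ lyapunov φ P ξ := fun ξ => le_trans (by positivity) (hlow ξ)
  have hup : ∀ ξ, lyapunov φ P ξ ≤ b * ‖liftRed φ ξ‖ ^ 2 := fun ξ => by
    have h := hVb (liftRed φ ξ).ofLp
    rwa [dotProduct_self_eq_norm_sq] at h
  have hup' : ∀ ξ ∈ roa φ P, lyapunov φ P ξ ≤ b * C ^ 2 * ‖ξ‖ ^ 2 := fun ξ hξ => by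
    refine (hup ξ).trans ?_
    rw [mul_assoc, ← mul_pow]
    exact mul_le_mul_of_nonneg_left
      (pow_le_pow_left₀ (norm_nonneg _) (hlift ξ (hRX hξ)) 2) hb.le
  -- `κ` comes from `ε‖μ‖² ≤ V ≤ bC²‖ξ‖²`. From `V' ≤ V - ε‖Φ̂‖²` and `V ≤ b‖Φ̂‖²` the natural
  -- factor is `1 - ε/b`; the larger `b/(b + ε)` is always in `(0, 1)`.
  refine sampledExpStable_of_lyapunov hΔt hflow hK hM hgrowth hRX hRU
    (κ := Real.sqrt (b * C ^ 2 / ε)) (Real.sqrt_nonneg _) (fun ξ hξ => ?_)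
    (V := lyapunov φ P) (b := b * C ^ 2) (θ := b / (b + ε)) ha (by positivity)
    ⟨by positivity, (div_lt_one (by positivity)).2 (by linarith)⟩ hlow hup' fun ξ hξ => ?_
  · refine (abs_le_of_sq_le_sq' ?_ (by positivity)).2
    rw [mul_pow, Real.sq_sqrt (by positivity), div_mul_eq_mul_div, le_div_iff₀ hε]
    have h1 := hdec ξ hξ
    have h2 := hnonneg (trajectory f g (controller φ P L Lw Λ ξ) ξ Δt)
    have h3 := hup' ξ hξ
    have h4 : 0 ≤ ε * ‖liftRed φ ξ‖ ^ 2 := by positivity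
    linarith
  · have h1 := hdec ξ hξ
    have h2 : 0 ≤ ε * ‖controller φ P L Lw Λ ξ‖ ^ 2 := by positivity
    have h3 : 0 ≤ ε * ‖liftRed φ ξ‖ ^ 2 := by positivity
    refine ⟨?_, ?_⟩
    · have h4 : lyapunov φ P ξ ≤ 1 := hξ
      change lyapunov φ P _ ≤ 1
      linarith
    · rw [div_mul_eq_mul_div, le_div_iff₀ (by positivity)]
      have h4 := mul_le_mul_of_nonneg_left (hup ξ) hε.le
      have h5 := mul_le_mul_of_nonneg_right
        (show lyapunov φ P (trajectory f g (controller φ P L Lw Λ ξ) ξ Δt) ≤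
          lyapunov φ P ξ - ε * ‖liftRed φ ξ‖ ^ 2 by linarith) (by positivity : 0 ≤ b + ε)
      nlinarith [mul_nonneg hε.le h3]
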